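/- Let $n\ge 0$ be an integer, let $\mu$ be a partition and let $\lambda=(\lambda_1,\dots,\lambda_n)\in(\mathbb{Z}_{\ge 0})^n$ be a composition with $|\lambda|=|\mu|$. For partitions $\eta,\kappa$ of the same size let $K_{\eta\kappa}(q)\in\mathbb{Z}[q]$ be the Kostka–Foulkes polynomial, defined by the expansion of Schur functions in Hall–Littlewood functions, $s_\eta(x)=\sum_{\kappa}K_{\eta\kappa}(q)P_\kappa(x;q)$. For a partition $\kappa$ let $K_{\eta\kappa}=K_{\eta\kappa}(1)$, and for a composition $\lambda$ put $K_{\eta\lambda}=K_{\eta\lambda^+}$, where $\lambda^+$ is the partition obtained by sorting the components of $\lambda$. Write $l(\eta)$ for the number of nonzero parts of $\eta$, $\mu'$ for the conjugate of $\mu$, $\binom{x}{2}=x(x-1)/2$, $(q)_m=\prod_{i=1}^m(1-q^i)$, and $$\begin{bmatrix} m\\ k\end{bmatrix}=\frac{(q)_m}{(q)_k(q)_{m-k}}\quad(0\le k\le m),\qquad \begin{bmatrix} m\\ k\end{bmatrix}=0\quad\text{otherwise}.$$ Then $$\sum_{\eta:\ |\eta|=|\mu|,\ l(\eta)\le n}K_{\eta\lambda}\,K_{\eta\mu}(q)=\sum_{\{\nu\}}q^{\phi(\{\nu\})}\prod_{1\le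 a\le n-1}\ \prod_{1\le i\le\mu_1}\begin{bmatrix}\nu^{(a+1)}_i-\nu^{(a)}_{i+1}\\ \nu^{(a)}_i-\nu^{(a)}_{i+1}\end{bmatrix},\qquad \phi(\{\nu\})=\sum_{a=0}^{n-1}\sum_{i=1}^{\mu_1}\binom{\nu^{(a+1)}_i-\nu^{(a)}_i}{2},$$ where $\{\nu\}$ runs over the sequences of Young diagrams $\nu^{(1)},\dots,\nu^{(n-1)}$ with $$\emptyset=:\nu^{(0)}\subseteq\nu^{(1)}\subseteq\cdots\subseteq\nu^{(n-1)}\subseteq\nu^{(n)}:=\mu',\qquad |\nu^{(a)}|=\lambda_1+\cdots+\lambda_a\quad(1\le a\le n-1),$$ and $\nu_i$ denotes the length of the $i$-th row of $\nu$. (For $n=0$, so that $\lambda$ and $\mu$ are empty, there is exactly one, trivial, sequence.) -/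

import Mathlib

open Finset Polynomial

namespace HallLittlewood

/-! Partitions are Mathlib's Young diagrams: for `μ : YoungDiagram`, the part `μ_{i+1}` is
`μ.rowLen i`, the number of parts `l(μ)` is `μ.colLen 0`, the size `|μ|` is `μ.card`, the conjugate
`μ'` is `μ.transpose`, and `≤` is containment of diagrams. The indeterminate `q` is
`Polynomial.X : ℤ[X]`. -/

/-- There are finitely many partitions of `d`. -/
theorem finite_setOf_card_eq (d : ℕ) : {μ : YoungDiagram | μ.card = d}.Finite := by
  have hinj : Function.Injective (YoungDiagram.cells) := fun _ _ h => YoungDiagram.ext h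
  refine Set.Finite.of_finite_image (f := YoungDiagram.cells) ?_ hinj.injOn
  refine ((range d ×ˢ range d).powerset.finite_toSet).subset ?_
  rintro _ ⟨μ, hμ, rfl⟩
  simp only [Set.mem_ofPred_eq] at hμ
  simp only [coe_powerset, Set.mem_preimage, Set.mem_powerset_iff, coe_subset]
  rintro ⟨i, j⟩ hc
  have hc' : (i, j) ∈ μ := (YoungDiagram.mem_cells _).1 hc
  have h1 : i < μ.colLen j := YoungDiagram.mem_iff_lt_colLen.1 hc'
  have h2 : j < μ.rowLen i := YoungDiagram.mem_iff_lt_rowLen.1 hc'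
  have h3 : μ.colLen j ≤ d := by
    rw [YoungDiagram.colLen_eq_card, ← hμ]
    exact card_le_card (filter_subset _ _)
  have h4 : μ.rowLen i ≤ d := by
    rw [YoungDiagram.rowLen_eq_card, ← hμ]
    exact card_le_card (filter_subset _ _)
  simp only [mem_product, mem_range]
  omega

/-- The finite set of all partitions of `d`. -/
noncomputable def partitionsOf (d : ℕ) : Finset YoungDiagram :=
  (finite_setOf_card_eq d).toFinset

/-- The field `ℚ(q)(x_1, …, x_N)`, as the fraction field of `ℤ[q][x_1, …, x_N]`. -/
abbrev RatField (N : ℕ) : Type := FractionRing (MvPolynomial (Fin N) ℤ[X])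

/-- The variable `x_{i+1}` in `ℚ(q)(x_1, …, x_N)`. -/
noncomputable def xvar (N : ℕ) (i : Fin N) : RatField N :=
  algebraMap (MvPolynomial (Fin N) ℤ[X]) (RatField N) (MvPolynomial.X i)

/-- The inclusion of `ℤ[q]` in `ℚ(q)(x_1, …, x_N)`. -/
noncomputable def coeffHom (N : ℕ) : ℤ[X] →+* RatField N :=
  (algebraMap (MvPolynomial (Fin N) ℤ[X]) (RatField N)).comp MvPolynomial.C

/-- The Schur polynomial `s_μ(x_1, …, x_N)`, the quotient of alternants
`det (x_i ^ (μ_j + N - j)) / det (x_i ^ (N - j))`; it is zero if `μ` has more than `N` parts. -/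
noncomputable def schurPoly (N : ℕ) (μ : YoungDiagram) : RatField N :=
  if μ.colLen 0 ≤ N then
    (Matrix.of fun i j : Fin N => xvar N i ^ (μ.rowLen j + (N - 1 - (j : ℕ)))).det /
      (Matrix.of fun i j : Fin N => xvar N i ^ (N - 1 - (j : ℕ))).det
  else 0

/-- `v_m(q) = ∏_{i=1}^m (1 - q^i) / (1 - q)`, the factors being written as geometric sums. -/
noncomputable def vFactor (m : ℕ) : ℤ[X] :=
  ∏ i ∈ range m, ∑ j ∈ range (i + 1), (X : ℤ[X]) ^ j

/-- `v_μ(q) = ∏_{k ≥ 0} v_{m_k}(q)`, where `m_k` is the number of `i ∈ {1, …, N}` with `μ_i = k`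
(parts equal to zero are counted). -/
noncomputable def vPoly (N : ℕ) (μ : YoungDiagram) : ℤ[X] :=
  ∏ k ∈ range (μ.rowLen 0 + 1), vFactor #{i : Fin N | μ.rowLen i = k}

/-- The Hall–Littlewood polynomial `P_μ(x_1, …, x_N; q)`, that is
`v_μ(q)⁻¹ ∑_{w ∈ S_N} w (x^μ ∏_{i < j} (x_i - q x_j) / (x_i - x_j))`; it is zero if `μ` has more
than `N` parts. -/
noncomputable def hallLittlewoodP (N : ℕ) (μ : YoungDiagram) : RatField N :=
  if μ.colLen 0 ≤ N then
    (coeffHom N (vPoly N μ))⁻¹ *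
      ∑ w : Equiv.Perm (Fin N),
        (∏ i : Fin N, xvar N (w i) ^ μ.rowLen i) *
          ∏ p : Fin N × Fin N with p.1 < p.2,
            (xvar N (w p.1) - coeffHom N X * xvar N (w p.2)) /
              (xvar N (w p.1) - xvar N (w p.2))
  else 0

/-- `c` is the row of the transition matrix that belongs to the Schur function `s_η`: one has
`s_η(x) = ∑_{|μ| = |η|} c_μ(q) P_μ(x; q)` as an identity of symmetric functions, i.e. in every
number `N` of variables, and `c_μ = 0` if `|μ| ≠ |η|`. -/
def IsHallLittlewoodExpansion (η : YoungDiagram) (c : YoungDiagram → ℤ[X]) : Prop :=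
  (∀ μ : YoungDiagram, μ.card ≠ η.card → c μ = 0) ∧
    ∀ N : ℕ, schurPoly N η = ∑ μ ∈ partitionsOf η.card, coeffHom N (c μ) * hallLittlewoodP N μ

open Classical in
/-- The Kostka–Foulkes polynomial `K_{ημ}(q) ∈ ℤ[q]`: the coefficient of `P_μ(x; q)` in the
expansion of `s_η(x)`. -/
noncomputable def kostkaFoulkes (η μ : YoungDiagram) : ℤ[X] :=
  if h : ∃ c, IsHallLittlewoodExpansion η c then h.choose μ else 0

/-- The partition obtained by rearranging the components of a composition. -/
noncomputable def sortedDiagram {n : ℕ} (lam : Fin n → ℕ) : YoungDiagram :=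
  YoungDiagram.ofRowLens ((univ.val.map lam).sort (· ≥ ·))
    (Multiset.pairwise_sort _ _).sortedGE

/-- The Kostka number `K_{ηλ} = K_{ηλ}(1)`, extended to compositions `λ` by invariance under
permutations of the components of `λ`. -/
noncomputable def kostkaNumber {n : ℕ} (η : YoungDiagram) (lam : Fin n → ℕ) : ℤ :=
  (kostkaFoulkes η (sortedDiagram lam)).eval 1

/-- `(q)_m = ∏_{i=1}^m (1 - q^i)`. -/
noncomputable def qPoch (m : ℕ) : ℤ[X] := ∏ i ∈ range m, (1 - X ^ (i + 1))

/-- The field `ℚ(q)`, as the fraction field of `ℤ[q]`. -/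
abbrev QField : Type := FractionRing ℤ[X]

/-- The `q`-binomial coefficient `[m; k] = (q)_m / ((q)_k (q)_{m-k})` for `0 ≤ k ≤ m`, and zero
otherwise. -/
noncomputable def qBinom (m k : ℕ) : QField :=
  if k ≤ m then
    algebraMap ℤ[X] QField (qPoch m) /
      (algebraMap ℤ[X] QField (qPoch k) * algebraMap ℤ[X] QField (qPoch (m - k)))
  else 0

/-- The sequences of Young diagrams `∅ = ν^{(0)} ⊆ ν^{(1)} ⊆ … ⊆ ν^{(n-1)} ⊆ ν^{(n)} = μ'` with
`|ν^{(a)}| = λ_1 + ⋯ + λ_a` for `1 ≤ a ≤ n - 1`. -/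
def diagramChains {n : ℕ} (μ : YoungDiagram) (lam : Fin n → ℕ) :
    Set (Fin (n + 1) → YoungDiagram) :=
  {ν | ν 0 = ⊥ ∧ ν (Fin.last n) = μ.transpose ∧
    (∀ a : Fin n, ν a.castSucc ≤ ν a.succ) ∧
    ∀ a : Fin (n + 1), 1 ≤ (a : ℕ) → (a : ℕ) ≤ n - 1 →
      (ν a).card = ∑ k : Fin n with k.val < a.val, lam k}

theorem finite_diagramChains {n : ℕ} (μ : YoungDiagram) (lam : Fin n → ℕ) :
    (diagramChains μ lam).Finite := by
  have hfin : {ν : YoungDiagram | ν ≤ μ.transpose}.Finite := by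
    have hinj : Function.Injective (YoungDiagram.cells) := fun _ _ h => YoungDiagram.ext h
    refine Set.Finite.of_finite_image (f := YoungDiagram.cells) ?_ hinj.injOn
    refine (μ.transpose.cells.powerset.finite_toSet).subset ?_
    rintro _ ⟨ν, hν, rfl⟩
    simpa using YoungDiagram.cells_subset_iff.2 hν
  refine (Set.Finite.pi' (fun _ : Fin (n + 1) => hfin)).subset ?_
  rintro ν ⟨-, hlast, hmono, -⟩ a
  have hm : Monotone ν := Fin.monotone_iff_le_succ.2 hmono
  exact (hm (Fin.le_last a)).trans hlast.le

/-- The exponent `φ({ν}) = ∑_{a=0}^{n-1} ∑_{i=1}^{μ_1} binom(ν^{(a+1)}_i - ν^{(a)}_i, 2)`; the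
differences are nonnegative since the diagrams increase with `a`. -/
def chainExponent {n : ℕ} (μ : YoungDiagram) (ν : Fin (n + 1) → YoungDiagram) : ℕ :=
  ∑ a : Fin n, ∑ i ∈ range (μ.rowLen 0),
    ((ν a.succ).rowLen i - (ν a.castSucc).rowLen i).choose 2

/-- The product over `1 ≤ a ≤ n - 1` and `1 ≤ i ≤ μ_1` of the `q`-binomial coefficients
`[ν^{(a+1)}_i - ν^{(a)}_{i+1}; ν^{(a)}_i - ν^{(a)}_{i+1}]`; both differences are nonnegative since
the diagrams increase with `a`. -/
noncomputable def chainProduct {n : ℕ} (μ : YoungDiagram) (ν : Fin (n + 1) → YoungDiagram) :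
    QField :=
  ∏ a : Fin n with 1 ≤ a.val, ∏ i ∈ range (μ.rowLen 0),
    qBinom ((ν a.succ).rowLen i - (ν a.castSucc).rowLen (i + 1))
      ((ν a.castSucc).rowLen i - (ν a.castSucc).rowLen (i + 1))

end HallLittlewood

/-!
The identity computes in two ways the coefficient of the Hall–Littlewood function `P_μ(x; q)` in the
product `h_λ = h_{λ_1} ⋯ h_{λ_n}` of complete symmetric functions.

On the one hand, multiplying `P_μ` by `h_r` is described by a Pieri formula
(`completeSym_mul_hlP`) whose coefficients are products over the columns,
`∏ q^{binom(ν'_i - μ'_i, 2)} [ν'_i - μ'_{i+1}; μ'_i - μ'_{i+1}]`. Iterating it from `P_∅ = 1` gives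
the sum over chains of conjugate diagrams (`chainCoeff_eq_sum`). The Pieri formula for elementary
symmetric functions (`signedElem_mul_hlP`) comes first: multiplication by `∏ (1 + u x_i)` adds `0`
or `1` to each exponent of the defining sum of `P_μ`, and exponents that are out of order by one may
be exchanged at the cost of a factor `t` (`hlSum_add_single`), so that sorting a block of equal
parts produces a Gaussian binomial. The two Pieri matrices are inverse to each other up to signs
(`sum_vStrip_mul_hStrip`): their product factorizes over the columns, and a single column reduces to
an alternating sum of `q`-binomial coefficients. Since the generating functions of the elementary
and the complete symmetric functions are inverse as well, the second Pieri formula follows.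

On the other hand, `h_λ` is a combination of Schur functions, each of which is `∑_μ K_{ημ}(q) P_μ(x;
q)`, and it remains to see that the coefficient of `s_η` in `h_λ` is `K_{ηλ}(1)`. All of the above
holds for every field and every parameter `t` with `v_m(t) ≠ 0` for all `m`, with coefficients that
are polynomials in `t` and do not depend on the number of variables. The parameter `t = 0` gives
Schur functions, and removing the first column of `η` shows by induction that the expansion of `s_η`
exists with integral polynomial coefficients for all such `t` at once, unitriangular for the
dominance order (`exists_isUniversalExpansion`). At `t = 1` the `P_μ` are the monomial symmetric
functions, and the coefficient of the monomial function of `μ` in `h_κ` is the number of nonnegative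
integer matrices with row sums `κ` and column sums `μ`, which is symmetric in `κ` and `μ`. With
`T_{ηκ}` the coefficient of `s_η` in `h_κ`, this says that `Tᵀ K(1)` is symmetric, and two
unitriangular matrices with this property are equal (`eval_zero_chainCoeff_eq`).

Specializing to `t = 1` also shows that the `P_μ(x; q)` are linearly independent
(`eq_zero_of_sum_hlP`). Hence the Kostka–Foulkes polynomials are the entries of the transition
matrix (`kostkaFoulkes_eq`), and the two expressions for the coefficient of `P_μ` in `h_λ` agree.
-/

namespace HallLittlewood

/-! ### Gaussian binomial coefficients -/

/-- The Gaussian binomial coefficient as a polynomial in `q`, by the `q`-Pascal recursion; it is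
zero for `k > m`. -/
noncomputable def gauss : ℕ → ℕ → ℤ[X]
  | _, 0 => 1
  | 0, _ + 1 => 0
  | m + 1, k + 1 => gauss m k + X ^ (k + 1) * gauss m (k + 1)

@[simp] theorem gauss_zero_right (m : ℕ) : gauss m 0 = 1 := by cases m <;> rfl

theorem gauss_succ_succ (m k : ℕ) :
    gauss (m + 1) (k + 1) = gauss m k + X ^ (k + 1) * gauss m (k + 1) := rfl

theorem gauss_eq_zero {m k : ℕ} (h : m < k) : gauss m k = 0 := by
  induction m generalizing k with
  | zero =>
    obtain ⟨k, rfl⟩ := Nat.exists_eq_succ_of_ne_zero h.ne'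
    rfl
  | succ m ih =>
    obtain ⟨k, rfl⟩ := Nat.exists_eq_succ_of_ne_zero (by omega : k ≠ 0)
    rw [Nat.succ_eq_add_one, gauss_succ_succ, ih (by omega), ih (by omega)]
    simp

@[simp] theorem gauss_self (m : ℕ) : gauss m m = 1 := by
  induction m with
  | zero => rfl
  | succ m ih => rw [gauss_succ_succ, ih, gauss_eq_zero (Nat.lt_succ_self m)]; simp

@[simp] theorem vFactor_zero : vFactor 0 = 1 := rfl

theorem vFactor_succ (m : ℕ) : vFactor (m + 1) = vFactor m * ∑ j ∈ range (m + 1), X ^ j :=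
  prod_range_succ _ _

theorem gauss_mul_vFactor (m k : ℕ) :
    gauss (m + k) k * (vFactor k * vFactor m) = vFactor (m + k) := by
  induction hn : m + k generalizing m k with
  | zero =>
    obtain ⟨rfl, rfl⟩ : m = 0 ∧ k = 0 := by omega
    simp
  | succ n ih =>
    rcases k with _ | k
    · obtain rfl : m = n + 1 := by omega
      simp
    rcases m with _ | m
    · obtain rfl : k = n := by omega
      simp
    have h1 := ih (m + 1) k (by omega)
    have h2 := ih m (k + 1) (by omega)
    obtain rfl : n = m + k + 1 := by omega
    rw [gauss_succ_succ, vFactor_succ (m + k + 1)]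
    have h3 : (∑ j ∈ range (m + k + 1 + 1), (X : ℤ[X]) ^ j) =
        (∑ j ∈ range (k + 1), X ^ j) + X ^ (k + 1) * ∑ j ∈ range (m + 1), X ^ j := by
      rw [show m + k + 1 + 1 = (k + 1) + (m + 1) by omega, sum_range_add, mul_sum]
      simp_rw [pow_add]
    rw [h3, mul_add]
    conv_rhs => arg 1; rw [← h1]
    conv_rhs => arg 2; rw [← h2]
    rw [vFactor_succ k, vFactor_succ m]
    ring

theorem gauss_mul_vFactor' {m k : ℕ} (h : k ≤ m) :
    gauss m k * (vFactor k * vFactor (m - k)) = vFactor m := by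
  conv_rhs => rw [← Nat.sub_add_cancel h, ← gauss_mul_vFactor]
  rw [Nat.sub_add_cancel h]

theorem one_sub_pow_mul_vFactor (m : ℕ) : vFactor m * (1 - X) ^ m = qPoch m := by
  rw [vFactor, qPoch, ← card_range m, ← prod_const, card_range, ← prod_mul_distrib]
  refine prod_congr rfl fun i _ => ?_
  rw [geom_sum_mul_neg]

theorem qPoch_ne_zero (m : ℕ) : qPoch m ≠ 0 := by
  rw [qPoch, prod_ne_zero_iff]
  intro i _ h
  have := congrArg (eval 0) h
  simp at this

theorem vFactor_ne_zero (m : ℕ) : vFactor m ≠ 0 := fun h =>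
  qPoch_ne_zero m (by rw [← one_sub_pow_mul_vFactor, h, zero_mul])

@[simp] theorem eval_zero_vFactor (m : ℕ) : (vFactor m).eval 0 = 1 := by
  rw [vFactor, eval_prod]
  refine prod_eq_one fun i _ => ?_
  rw [eval_finsetSum, sum_range_succ']
  simp

theorem eval_one_vFactor (m : ℕ) : (vFactor m).eval 1 = (m.factorial : ℤ) := by
  induction m with
  | zero => simp
  | succ m ih => simp [vFactor_succ, ih, Nat.factorial_succ, eval_finsetSum, mul_comm]

theorem eval_zero_gauss {m k : ℕ} (h : k ≤ m) : (gauss m k).eval 0 = 1 := by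
  have := congrArg (eval 0) (gauss_mul_vFactor' h)
  simpa using this

theorem gauss_symm {m k : ℕ} (h : k ≤ m) : gauss m (m - k) = gauss m k := by
  have h1 := gauss_mul_vFactor' h
  have h2 := gauss_mul_vFactor' (Nat.sub_le m k)
  rw [Nat.sub_sub_self h] at h2
  refine mul_right_cancel₀ (mul_ne_zero (vFactor_ne_zero k) (vFactor_ne_zero (m - k))) ?_
  rw [h1, ← h2]; ring

/-- The trinomial revision identity for Gaussian binomial coefficients. -/
theorem gauss_mul_gauss {m j s : ℕ} (hj : j ≤ m) (hs : s ≤ j) :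
    gauss m j * gauss j s = gauss m s * gauss (m - s) (j - s) := by
  have h1 := gauss_mul_vFactor' hj
  have h2 := gauss_mul_vFactor' hs
  have h3 := gauss_mul_vFactor' (hs.trans hj)
  have h4 := gauss_mul_vFactor' (show j - s ≤ m - s by omega)
  rw [show m - s - (j - s) = m - j by omega] at h4
  refine mul_right_cancel₀ (mul_ne_zero (mul_ne_zero (vFactor_ne_zero s) (vFactor_ne_zero (j - s)))
    (vFactor_ne_zero (m - j))) ?_
  rw [← h2] at h1
  rw [← h4] at h3
  calc _ = vFactor m := by rw [← h1]; ring
    _ = _ := by rw [← h3]; ring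

/-- The `q`-binomial expansion of `∏_{l ≤ n} (1 - q ^ l)`, whose factor for `l = 0` vanishes. -/
theorem sum_neg_one_pow_mul_gauss (n : ℕ) :
    ∑ i ∈ range (n + 2), (-1) ^ i * gauss (n + 1) i * X ^ i.choose 2 = 0 := by
  have h1 : ∑ i ∈ range (n + 1), (-1) ^ i * gauss n i * X ^ (i + 1).choose 2 =
      ∑ i ∈ range (n + 1), (-1) ^ (i + 1) * (X ^ (i + 1) * gauss n (i + 1)) *
        X ^ (i + 1).choose 2 + 1 := by
    rw [sum_range_succ', sum_range_succ (fun i => (-1) ^ (i + 1) *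
      (X ^ (i + 1) * gauss n (i + 1)) * X ^ (i + 1).choose 2), gauss_eq_zero (Nat.lt_succ_self n)]
    simp only [zero_add, pow_zero, gauss_zero_right, mul_one, mul_zero, zero_mul, add_zero]
    rw [show Nat.choose 1 2 = 0 from rfl, pow_zero, mul_one]
    congr 1
    refine sum_congr rfl fun i _ => ?_
    rw [show (i + 1 + 1).choose 2 = (i + 1) + (i + 1).choose 2 by
      rw [Nat.choose_succ_succ' (i + 1) 1, Nat.choose_one_right], pow_add]
    ring
  rw [sum_range_succ']
  simp only [gauss_succ_succ, mul_add, add_mul, sum_add_distrib]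
  have h2 : ∑ i ∈ range (n + 1), (-1) ^ (i + 1) * gauss n i * X ^ (i + 1).choose 2 =
      -∑ i ∈ range (n + 1), (-1) ^ i * gauss n i * X ^ (i + 1).choose 2 := by
    rw [← sum_neg_distrib]
    exact sum_congr rfl fun i _ => by ring
  rw [h2, h1]
  simp

theorem qBinom_eq (m k : ℕ) : qBinom m k = algebraMap ℤ[X] QField (gauss m k) := by
  rw [qBinom]
  split_ifs with h
  · have hinj := IsFractionRing.injective ℤ[X] QField
    have hne : ∀ m, algebraMap ℤ[X] QField (qPoch m) ≠ 0 := fun m =>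
      (map_ne_zero_iff _ hinj).2 (qPoch_ne_zero m)
    rw [div_eq_iff (mul_ne_zero (hne _) (hne _)), ← map_mul, ← map_mul]
    congr 1
    rw [← one_sub_pow_mul_vFactor, ← one_sub_pow_mul_vFactor, ← one_sub_pow_mul_vFactor,
      ← gauss_mul_vFactor' h]
    conv_lhs => rw [← Nat.add_sub_cancel' h, pow_add, Nat.add_sub_cancel' h]
    ring
  · rw [gauss_eq_zero (not_le.1 h), map_zero]

/-! ### Young diagrams and their columns -/

theorem colLen_le_of_le {μ ν : YoungDiagram} (h : μ ≤ ν) (j : ℕ) : μ.colLen j ≤ ν.colLen j := by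
  by_contra! hlt
  have := h (YoungDiagram.mem_iff_lt_colLen.2 hlt)
  exact lt_irrefl _ (YoungDiagram.mem_iff_lt_colLen.1 this)

theorem le_iff_colLen {μ ν : YoungDiagram} : μ ≤ ν ↔ ∀ j, μ.colLen j ≤ ν.colLen j := by
  refine ⟨colLen_le_of_le, fun h => ?_⟩
  rintro ⟨i, j⟩ hc
  exact YoungDiagram.mem_iff_lt_colLen.2 ((YoungDiagram.mem_iff_lt_colLen.1 hc).trans_le (h j))

theorem ext_colLen {μ ν : YoungDiagram} (h : ∀ j, μ.colLen j = ν.colLen j) : μ = ν :=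
  le_antisymm (le_iff_colLen.2 fun j => (h j).le) (le_iff_colLen.2 fun j => (h j).ge)

theorem colLen_eq_zero_iff {μ : YoungDiagram} {j : ℕ} : μ.colLen j = 0 ↔ μ.rowLen 0 ≤ j := by
  rw [← not_lt, ← YoungDiagram.mem_iff_lt_rowLen, YoungDiagram.mem_iff_lt_colLen,
    Nat.pos_iff_ne_zero,    not_not]

theorem card_eq_sum_colLen (μ : YoungDiagram) {M : ℕ} (hM : μ.rowLen 0 ≤ M) :
    μ.card = ∑ j ∈ range M, μ.colLen j := by
  have h : μ.cells = (range M).biUnion μ.col := by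
    ext ⟨i, j⟩
    simp only [YoungDiagram.mem_cells, mem_biUnion, mem_range, YoungDiagram.mem_col_iff]
    refine ⟨fun h => ⟨j, ?_, h, rfl⟩, fun ⟨_, _, h, _⟩ => h⟩
    have := YoungDiagram.mem_iff_lt_rowLen.1 h
    exact (this.trans_le (μ.rowLen_anti 0 i (Nat.zero_le i))).trans_le hM
  rw [YoungDiagram.card, h, card_biUnion]
  · simp_rw [← YoungDiagram.colLen_eq_card]
  · intro a _ b _ hab
    rw [Function.onFun, disjoint_left]
    rintro c h1 h2
    exact hab ((YoungDiagram.mem_col_iff.1 h1).2.symm.trans (YoungDiagram.mem_col_iff.1 h2).2)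

theorem rowLen_le_card (μ : YoungDiagram) (i : ℕ) : μ.rowLen i ≤ μ.card := by
  rw [YoungDiagram.rowLen_eq_card]; exact card_le_card (filter_subset _ _)

theorem colLen_le_card (μ : YoungDiagram) (i : ℕ) : μ.colLen i ≤ μ.card := by
  rw [YoungDiagram.colLen_eq_card]; exact card_le_card (filter_subset _ _)

theorem card_transpose (μ : YoungDiagram) : μ.transpose.card = μ.card := by
  simp [YoungDiagram.card, YoungDiagram.transpose]

/-- A weakly decreasing sequence that vanishes eventually is the sequence of column lengths of a
Young diagram. -/
theorem exists_colLen_eq (c : ℕ → ℕ) (hc : Antitone c) (M : ℕ) (hM : c M = 0) :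
    ∃ μ : YoungDiagram, ∀ j, μ.colLen j = c j := by
  let μ : YoungDiagram :=
    { cells := (range (c 0) ×ˢ range M).filter fun p => p.1 < c p.2
      isLowerSet := by
        rintro ⟨i, j⟩ ⟨i', j'⟩ h hij
        obtain ⟨h1, h2⟩ := Prod.mk_le_mk.1 h
        simp only [coe_filter, mem_product, mem_range, Set.mem_ofPred_eq] at hij ⊢
        have := hc h2
        omega }
  refine ⟨μ, fun j => ?_⟩
  have key : ∀ i, i < μ.colLen j ↔ i < c j := by
    intro i
    rw [← YoungDiagram.mem_iff_lt_colLen, ← YoungDiagram.mem_cells]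
    simp only [μ, mem_filter, mem_product, mem_range]
    refine ⟨fun h => h.2, fun h => ⟨⟨h.trans_le (hc (Nat.zero_le j)), ?_⟩, h⟩⟩
    by_contra! hj
    have := hc hj
    omega
  have h1 := key (μ.colLen j)
  have h2 := key (c j)
  omega

theorem mem_partitionsOf {d : ℕ} {μ : YoungDiagram} : μ ∈ partitionsOf d ↔ μ.card = d := by
  simp [partitionsOf]

theorem card_le_of_le {μ ν : YoungDiagram} (h : μ ≤ ν) : μ.card ≤ ν.card :=
  card_le_card (YoungDiagram.cells_subset_iff.2 h)

theorem eq_of_le_of_card_eq {μ ν : YoungDiagram} (h : μ ≤ ν) (hc : μ.card = ν.card) : μ = ν :=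
  YoungDiagram.ext (eq_of_subset_of_card_le (YoungDiagram.cells_subset_iff.2 h) hc.ge)

theorem card_eq_zero_iff {μ : YoungDiagram} : μ.card = 0 ↔ μ = ⊥ := by
  refine ⟨fun h => (eq_of_le_of_card_eq bot_le ?_).symm, ?_⟩
  · rw [h]; rfl
  · rintro rfl; rfl

theorem lt_rowLen_iff_lt_colLen {μ : YoungDiagram} {i j : ℕ} : j < μ.rowLen i ↔ i < μ.colLen j := by
  rw [← YoungDiagram.mem_iff_lt_rowLen, YoungDiagram.mem_iff_lt_colLen]

/-! ### Adding vertical strips to weakly decreasing sequences -/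

section Bump

variable {A : Type*} [CommRing A]

/-- The value at `t` of a polynomial in `q` with integer coefficients. -/
noncomputable def evalAt (t : A) : ℤ[X] →+* A := eval₂RingHom (Int.castRingHom A) t

@[simp] theorem evalAt_X (t : A) : evalAt t X = t := by simp [evalAt]

theorem map_evalAt {B : Type*} [CommRing B] (φ : A →+* B) (t : A) (p : ℤ[X]) :
    φ (evalAt t p) = evalAt (φ t) p := by
  simp only [evalAt, coe_eval₂RingHom, hom_eval₂]
  congr 1
  exact RingHom.ext_int _ _

theorem evalAt_intCast (a : ℤ) (p : ℤ[X]) : evalAt (a : A) p = (p.eval a : ℤ) := by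
  have := map_evalAt (Int.castRingHom A) a p
  simp only [eq_intCast] at this
  rw [← this]
  simp [evalAt, eval₂_eq_eval_map]

/-- The sum of `u ^ |ε| f (l + ε)` over all `0`-`1` vectors `ε`. -/
def bumpSum (u : A) : List ℕ → (List ℕ → A) → A
  | [], f => f []
  | a :: l, f => bumpSum u l (fun s => f (a :: s)) + u * bumpSum u l (fun s => f ((a + 1) :: s))

theorem bumpSum_append (u : A) (l l' : List ℕ) (f : List ℕ → A) :
    bumpSum u (l ++ l') f = bumpSum u l fun s => bumpSum u l' fun s' => f (s ++ s') := by
  induction l generalizing f with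
  | nil => rfl
  | cons a l ih => simp only [List.cons_append, bumpSum, ih]

theorem bumpSum_congr (u : A) (l : List ℕ) {f g : List ℕ → A}
    (h : ∀ s, s.length = l.length → f s = g s) : bumpSum u l f = bumpSum u l g := by
  induction l generalizing f g with
  | nil => exact h [] rfl
  | cons a l ih =>
    simp only [bumpSum]
    rw [ih fun s hs => h (a :: s) (by simp [hs]), ih fun s hs => h ((a + 1) :: s) (by simp [hs])]

theorem bumpSum_sum {ι : Type*} (u : A) (l : List ℕ) (S : Finset ι) (f : ι → List ℕ → A) :
    bumpSum u l (fun s => ∑ i ∈ S, f i s) = ∑ i ∈ S, bumpSum u l (f i) := by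
  induction l generalizing f with
  | nil => rfl
  | cons a l ih => simp only [bumpSum, ih, mul_sum, sum_add_distrib]

theorem bumpSum_mul (u : A) (l : List ℕ) (c : A) (f : List ℕ → A) :
    bumpSum u l (fun s => c * f s) = c * bumpSum u l f := by
  induction l generalizing f with
  | nil => rfl
  | cons a l ih => simp only [bumpSum, ih]; ring

/-- Bumping a monomial multiplies it by `∏ (1 + u y_i)`. -/
theorem bumpSum_monomial (u : A) (y : List A) (l : List ℕ) (h : l.length = y.length) :
    bumpSum u l (fun s => (List.zipWith (fun z a => z ^ a) y s).prod) =
      (y.map fun z => 1 + u * z).prod * (List.zipWith (fun z a => z ^ a) y l).prod := by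
  induction l generalizing y with
  | nil =>
    obtain rfl : y = [] := List.length_eq_zero_iff.1 h.symm
    simp [bumpSum]
  | cons a l ih =>
    obtain ⟨z, y, rfl⟩ := List.exists_cons_of_length_eq_add_one h.symm
    have := ih y (by simpa using h)
    simp only [bumpSum, List.zipWith_cons_cons, List.prod_cons, bumpSum_mul, this, List.map_cons]
    ring

/-- The relation that lets one sort sequences whose adjacent entries are out of order by one. -/
def Straightens (t : A) (f : List ℕ → A) : Prop :=
  ∀ (p q : List ℕ) (a : ℕ), f (p ++ a :: (a + 1) :: q) = t * f (p ++ (a + 1) :: a :: q)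

theorem Straightens.append {t : A} {f : List ℕ → A} (hf : Straightens t f) (p : List ℕ) :
    Straightens t fun s => f (p ++ s) := by
  intro p' q a
  simpa only [List.append_assoc] using hf (p ++ p') q a

theorem Straightens.append_right {t : A} {f : List ℕ → A} (hf : Straightens t f) (q : List ℕ) :
    Straightens t fun s => f (s ++ q) := by
  intro p' q' a
  simpa only [List.append_assoc, List.cons_append] using hf p' (q' ++ q) a

theorem Straightens.move {t : A} {f : List ℕ → A} (hf : Straightens t f) (a r : ℕ) (q : List ℕ) :
    f (a :: (List.replicate r (a + 1) ++ q)) = t ^ r * f (List.replicate r (a + 1) ++ a :: q) := by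
  induction r generalizing f with
  | zero => simp
  | succ r ih =>
    have h1 := hf [] (List.replicate r (a + 1) ++ q) a
    have h2 := ih (hf.append [a + 1])
    simp only [List.nil_append, List.cons_append] at h1 h2
    rw [List.replicate_succ, List.cons_append, h1, h2, List.cons_append]
    ring

/-- Bumping a block of equal entries: sorting the result produces Gaussian binomials, by the
`q`-Pascal recursion. -/
theorem bumpSum_replicate {t : A} {f : List ℕ → A} (hf : Straightens t f) (u : A) (a m : ℕ) :
    bumpSum u (List.replicate m a) f = ∑ r ∈ range (m + 1),
      u ^ r * evalAt t (gauss m r) * f (List.replicate r (a + 1) ++ List.replicate (m - r) a) := by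
  induction m generalizing f with
  | zero => simp [bumpSum]
  | succ m ih =>
    have h1 := ih (hf.append [a])
    have h2 := ih (hf.append [a + 1])
    simp only [List.nil_append, List.cons_append] at h1 h2
    rw [sum_range_succ'] at h1
    rw [sum_range_succ] at h2
    rw [List.replicate_succ, bumpSum, h1, h2, sum_range_succ' _ (m + 1), sum_range_succ _ m]
    simp only [hf.move]
    rw [mul_add, mul_sum]
    have h3 : ∀ r ∈ range m, evalAt t (gauss (m + 1) (r + 1)) =
        evalAt t (gauss m r) + t ^ (r + 1) * evalAt t (gauss m (r + 1)) := by
      intro r _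
      rw [gauss_succ_succ]; simp only [map_add, map_mul, map_pow, evalAt_X]
    have h4 : ∀ r ∈ range m, u ^ (r + 1) * evalAt t (gauss (m + 1) (r + 1)) *
          f (List.replicate (r + 1) (a + 1) ++ List.replicate (m + 1 - (r + 1)) a) =
        u ^ (r + 1) * evalAt t (gauss m (r + 1)) * (t ^ (r + 1) *
          f (List.replicate (r + 1) (a + 1) ++ a :: List.replicate (m - (r + 1)) a)) +
        u * (u ^ r * evalAt t (gauss m r) *
          f ((a + 1) :: (List.replicate r (a + 1) ++ List.replicate (m - r) a))) := by
      intro r hr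
      have hr' := mem_range.1 hr
      rw [h3 r hr, ← List.cons_append (as := List.replicate r (a + 1)), ← List.replicate_succ,
        ← List.replicate_succ, show m - (r + 1) + 1 = m - r by omega,
        show m + 1 - (r + 1) = m - r by omega]
      ring
    rw [sum_congr rfl h4, sum_add_distrib]
    simp only [gauss_self, gauss_zero_right, map_one, Nat.sub_self, List.replicate_zero,
      List.append_nil, List.replicate_succ, pow_zero, Nat.sub_zero, List.nil_append]
    ring

/-- The weakly decreasing sequence with `m k` entries equal to `k` for `k < K`. -/
def blockList (m : ℕ → ℕ) : ℕ → List ℕ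
  | 0 => []
  | k + 1 => List.replicate (m k) k ++ blockList m k

/-- The weakly decreasing sequence obtained from `blockList m K` by adding one to `r k` of the
entries equal to `k`. -/
def bumpedList (m r : ℕ → ℕ) : ℕ → List ℕ
  | 0 => []
  | k + 1 => List.replicate (r k) (k + 1) ++ (List.replicate (m k - r k) k ++ bumpedList m r k)

theorem bumpedList_congr {m r r' : ℕ → ℕ} {K : ℕ} (h : ∀ k < K, r k = r' k) :
    bumpedList m r K = bumpedList m r' K := by
  induction K with
  | zero => rfl
  | succ K ih =>
    rw [bumpedList, bumpedList, h K (Nat.lt_succ_self K), ih fun k hk => h k (by omega)]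

/-- The function `r` on `{0, …, K - 1}`, extended by zero. -/
def extendZero {K : ℕ} (r : Fin K → ℕ) (k : ℕ) : ℕ := if h : k < K then r ⟨k, h⟩ else 0

@[simp] theorem extendZero_val {K : ℕ} (r : Fin K → ℕ) (k : Fin K) : extendZero r k = r k := by
  simp [extendZero]

theorem extendZero_of_le {K : ℕ} (r : Fin K → ℕ) {k : ℕ} (h : K ≤ k) : extendZero r k = 0 := by
  simp [extendZero, h]

theorem sum_piFinset_snoc {B : Type*} [AddCommMonoid B] {K : ℕ} (s : Fin (K + 1) → Finset ℕ)
    (g : (Fin (K + 1) → ℕ) → B) :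
    ∑ r ∈ Fintype.piFinset s, g r =
      ∑ a ∈ s (Fin.last K), ∑ r ∈ Fintype.piFinset fun k : Fin K => s k.castSucc,
        g (Fin.snoc (α := fun _ => ℕ) r a) := by
  rw [← sum_product']
  refine sum_bij' (fun r _ => (r (Fin.last K), fun k => r k.castSucc))
    (fun p _ => Fin.snoc (α := fun _ => ℕ) p.2 p.1) ?_ ?_ ?_ ?_ ?_
  · intro r hr
    rw [Fintype.mem_piFinset] at hr
    simp [hr]
  · rintro ⟨a, r⟩ h
    simp only [mem_product, Fintype.mem_piFinset] at h ⊢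
    intro k
    refine Fin.lastCases ?_ (fun k => ?_) k
    · simpa using h.1
    · simpa using h.2 k
  · intro r _
    exact Fin.snoc_init_self r
  · rintro ⟨a, r⟩ _
    simp
  · intro r _
    exact congrArg g (Fin.snoc_init_self r).symm

theorem bumpSum_blockList {t : A} {f : List ℕ → A} (hf : Straightens t f) (u : A) (m : ℕ → ℕ)
    (K : ℕ) :
    bumpSum u (blockList m K) f =
      ∑ r ∈ Fintype.piFinset fun k : Fin K => range (m k + 1),
        (∏ k : Fin K, (u ^ r k * evalAt t (gauss (m k) (r k)))) *
          f (bumpedList m (extendZero r) K) := by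
  induction K generalizing f with
  | zero => simp [blockList, bumpSum, bumpedList]
  | succ K ih =>
    have h1 : Straightens t fun s => bumpSum u (blockList m K) fun s' => f (s ++ s') := by
      intro p q a
      rw [← bumpSum_mul]
      refine bumpSum_congr u _ fun s _ => ?_
      exact hf.append_right s p q a
    rw [blockList, bumpSum_append, bumpSum_replicate h1, sum_piFinset_snoc]
    refine sum_congr rfl fun a _ => ?_
    rw [ih (hf.append _), mul_sum]
    refine sum_congr rfl fun r _ => ?_
    rw [Fin.prod_univ_castSucc]
    have h2 : bumpedList m (extendZero (Fin.snoc (α := fun _ => ℕ) r a)) (K + 1) =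
        List.replicate a (K + 1) ++ List.replicate (m K - a) K ++
          bumpedList m (extendZero r) K := by
      have h3 : extendZero (Fin.snoc (α := fun _ => ℕ) r a) K = a := by
        have := extendZero_val (Fin.snoc (α := fun _ => ℕ) r a) (Fin.last K)
        simpa using this
      rw [bumpedList, h3, List.append_assoc]
      congr 2
      refine bumpedList_congr fun k hk => ?_
      have := extendZero_val (Fin.snoc (α := fun _ => ℕ) r a) (Fin.castSucc ⟨k, hk⟩)
      rw [Fin.snoc_castSucc] at this
      exact this.trans (extendZero_val r ⟨k, hk⟩).symm
    rw [h2]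
    simp only [Fin.snoc_castSucc, Fin.snoc_last, Fin.val_castSucc, Fin.val_last]
    ring

/-- The multiplicities of the bumped sequence: `r k` entries `k` move to `k + 1`. -/
def bumpedMult (m r : ℕ → ℕ) : ℕ → ℕ
  | 0 => m 0 - r 0
  | k + 1 => m (k + 1) - r (k + 1) + r k

theorem bumpedList_eq (m r : ℕ → ℕ) (K : ℕ) (hm : m K = 0) :
    bumpedList m r K = blockList (bumpedMult m r) (K + 1) := by
  have key : ∀ K s, List.replicate s K ++ bumpedList m r K =
      List.replicate (s + if K = 0 then 0 else r (K - 1)) K ++ blockList (bumpedMult m r) K := by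
    intro K
    induction K with
    | zero => intro s; simp [bumpedList, blockList]
    | succ K ih =>
      intro s
      rw [bumpedList, ih, blockList, ← List.append_assoc, ← List.replicate_add]
      congr 3
      cases K <;> simp [bumpedMult]
  have := key K 0
  rw [List.replicate_zero, List.nil_append] at this
  rw [this, blockList]
  congr 2
  cases K <;> simp [bumpedMult, hm]

/-- The entries of a weakly decreasing sequence in terms of the numbers `c k` of entries that are
at least `k`. -/
theorem blockList_spec (c : ℕ → ℕ) (hc : Antitone c) (K : ℕ) :
    (blockList (fun k => c k - c (k + 1)) K).length = c 0 - c K ∧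
      ∀ i < c 0 - c K, (blockList (fun k => c k - c (k + 1)) K).getD i 0 =
        #{k ∈ range K | 1 ≤ k ∧ i + c K < c k} := by
  induction K with
  | zero => simp [blockList]
  | succ K ih =>
    have h1 := hc (Nat.le_succ K)
    have h2 := hc (Nat.zero_le K)
    simp only [Nat.succ_eq_add_one] at h1
    refine ⟨?_, fun i hi => ?_⟩
    · rw [blockList, List.length_append, List.length_replicate, ih.1]
      omega
    · rw [blockList]
      by_cases hlt : i < c K - c (K + 1)
      · rw [List.getD_append _ _ _ _ (by simpa using hlt), List.getD_replicate _ hlt]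
        have : {k ∈ range (K + 1) | 1 ≤ k ∧ i + c (K + 1) < c k} = Ico 1 (K + 1) := by
          ext k
          simp only [mem_filter, mem_range, mem_Ico]
          refine ⟨fun h => ⟨h.2.1, h.1⟩, fun h => ⟨h.2, h.1, ?_⟩⟩
          have := hc (show k ≤ K by omega)
          omega
        rw [this, Nat.card_Ico, Nat.add_sub_cancel]
      · rw [List.getD_append_right _ _ _ _ (by simpa using hlt), List.length_replicate,
          ih.2 _ (by omega)]
        congr 1
        ext k
        simp only [mem_filter, mem_range]
        rcases eq_or_ne k K with rfl | hk
        · omega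
        · omega

end Bump

/-! ### Hall–Littlewood sums and the Pieri formula for elementary symmetric functions -/

section Field

variable {F : Type*} [Field F] {N : ℕ}

/-- The factor `w (∏_{i < j} (x_i - t x_j) / (x_i - x_j))`. -/
def hlKernel (t : F) (x : Fin N → F) (w : Equiv.Perm (Fin N)) : F :=
  ∏ p : Fin N × Fin N with p.1 < p.2, (x (w p.1) - t * x (w p.2)) / (x (w p.1) - x (w p.2))

/-- The unnormalized Hall–Littlewood sum
`∑_{w ∈ S_N} w (x^α ∏_{i < j} (x_i - t x_j) / (x_i - x_j))`, for any composition `α`. -/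
def hlSum (t : F) (x : Fin N → F) (α : Fin N → ℕ) : F :=
  ∑ w : Equiv.Perm (Fin N), (∏ i, x (w i) ^ α i) * hlKernel t x w

theorem prod_mul_swap {B : Type*} [CommMonoid B] (g : Fin N × Fin N → B) {i j : Fin N}
    (hij : (j : ℕ) = i + 1) :
    ∏ p ∈ ({p : Fin N × Fin N | p.1 < p.2} : Finset _).erase (i, j),
        g (Equiv.swap i j p.1, Equiv.swap i j p.2) =
      ∏ p ∈ ({p : Fin N × Fin N | p.1 < p.2} : Finset _).erase (i, j), g p := by
  refine prod_equiv ((Equiv.swap i j).prodCongr (Equiv.swap i j)) ?_ fun p _ => rfl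
  rintro ⟨a, b⟩
  simp only [mem_erase, mem_filter, mem_univ, true_and, Equiv.prodCongr_apply, Prod.map_apply,
    Equiv.swap_apply_def, ne_eq, Prod.mk.injEq]
  split_ifs <;>
    simp only [Fin.ext_iff, Fin.lt_def, and_self, not_true_eq_false, false_and, iff_false] at * <;>
    omega

/-- Two adjacent exponents that are out of order by one may be exchanged at the cost of a factor
`t`. The terms of the difference cancel in pairs `w`, `w s`, where `s` is the adjacent
transposition. -/
theorem hlSum_add_single (t : F) {x : Fin N → F} (hx : Function.Injective x) (γ : Fin N → ℕ)
    {i j : Fin N} (hij : (j : ℕ) = i + 1) (hγ : γ i = γ j) :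
    hlSum t x (γ + Pi.single j 1) = t * hlSum t x (γ + Pi.single i 1) := by
  have hne : i ≠ j := fun h => by simp [h] at hij
  set s := Equiv.swap i j with hs
  set T := ({p : Fin N × Fin N | p.1 < p.2} : Finset _).erase (i, j) with hT
  let g : Equiv.Perm (Fin N) → F := fun w => ∏ k, x (w k) ^ γ k
  let D : Equiv.Perm (Fin N) → F := fun w =>
    ∏ p ∈ T, (x (w p.1) - t * x (w p.2)) / (x (w p.1) - x (w p.2))
  have hmem : (i, j) ∈ ({p : Fin N × Fin N | p.1 < p.2} : Finset _) := by
    simp only [mem_filter, mem_univ, true_and, Fin.lt_def]; omega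
  have hker : ∀ w, hlKernel t x w =
      (x (w i) - t * x (w j)) / (x (w i) - x (w j)) * D w := fun w =>
    (mul_prod_erase _ (fun p : Fin N × Fin N =>
      (x (w p.1) - t * x (w p.2)) / (x (w p.1) - x (w p.2))) hmem).symm
  have hD : ∀ w, D (w * s) = D w := fun w =>
    prod_mul_swap (fun p => (x (w p.1) - t * x (w p.2)) / (x (w p.1) - x (w p.2))) hij
  have hg : ∀ w, g (w * s) = g w := by
    intro w
    refine Fintype.prod_equiv s _ _ fun k => ?_
    have : γ (s k) = γ k := by
      rw [hs, Equiv.swap_apply_def]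
      split_ifs with h1 h2
      · rw [h1, hγ]
      · rw [h2, hγ]
      · rfl
    rw [this]; rfl
  have hmono : ∀ w k, (∏ l, x (w l) ^ (γ + Pi.single k 1 : Fin N → ℕ) l) = g w * x (w k) := by
    intro w k
    simp only [g, Pi.add_apply, pow_add, prod_mul_distrib]
    congr 1
    rw [prod_eq_single k]
    · simp
    · intro b _ hb
      simp [Pi.single_eq_of_ne hb]
    · simp
  rw [← sub_eq_zero, hlSum, hlSum, mul_sum, ← sum_sub_distrib]
  refine sum_involution (fun w _ => w * s) ?_ ?_ (fun _ _ => mem_univ _) ?_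
  · intro w _
    rw [hmono, hmono, hmono, hmono, hker, hker, hD, hg]
    have h1 : (w * s) i = w j := by simp [hs]
    have h2 : (w * s) j = w i := by simp [hs]
    rw [h1, h2]
    have h3 : x (w i) - x (w j) ≠ 0 := sub_ne_zero.2 fun h => hne (w.injective (hx h))
    have h4 : x (w j) - x (w i) ≠ 0 := sub_ne_zero.2 fun h => hne (w.injective (hx h)).symm
    field_simp
    ring
  · intro w _ _ h
    have := congrArg (fun v : Equiv.Perm (Fin N) => v i) h
    simp only [hs, Equiv.Perm.mul_apply, Equiv.swap_apply_left] at this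
    exact hne (w.injective this).symm
  · intro w _
    simp [mul_assoc, hs]

/-- `hlSum` as a function of lists of exponents, zero on lists of the wrong length. -/
def hlList (t : F) (x : Fin N → F) (l : List ℕ) : F :=
  if l.length = N then hlSum t x fun i => l.getD i 0 else 0

theorem getD_bump (p q : List ℕ) (a b k : ℕ) :
    (p ++ (a + b) :: q).getD k 0 = (p ++ a :: q).getD k 0 + if k = p.length then b else 0 := by
  induction p generalizing k with
  | nil => cases k <;> simp
  | cons c p ih =>
    cases k with
    | zero => simp
    | succ k => simpa using ih k

theorem getD_append_cons (p q : List ℕ) (a : ℕ) : (p ++ a :: q).getD p.length 0 = a := by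
  induction p with
  | nil => simp
  | cons c p ih => simp

theorem straightens_hlList (t : F) {x : Fin N → F} (hx : Function.Injective x) :
    Straightens t (hlList t x) := by
  intro p q a
  have hlen : (p ++ a :: (a + 1) :: q).length = p.length + q.length + 2 := by
    simp only [List.length_append, List.length_cons]; omega
  have hlen' : (p ++ (a + 1) :: a :: q).length = p.length + q.length + 2 := by
    simp only [List.length_append, List.length_cons]; omega
  rw [hlList, hlList, hlen, hlen']
  split_ifs with h
  · have h1 := getD_append_cons p (a :: q) a
    have h2 := getD_append_cons (p ++ [a]) q a
    simp only [List.append_assoc, List.cons_append, List.nil_append, List.length_append,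
      List.length_cons, List.length_nil, zero_add] at h2
    have key := hlSum_add_single t hx (fun k => (p ++ a :: a :: q).getD k 0)
      (i := ⟨p.length, by omega⟩) (j := ⟨p.length + 1, by omega⟩) rfl (h1.trans h2.symm)
    have e1 : (fun k : Fin N => (p ++ a :: (a + 1) :: q).getD k 0) =
        (fun k : Fin N => (p ++ a :: a :: q).getD k 0) +
          Pi.single (⟨p.length + 1, by omega⟩ : Fin N) 1 := by
      funext k
      have := getD_bump (p ++ [a]) q a 1 k
      simp only [List.append_assoc, List.cons_append, List.nil_append, List.length_append,
        List.length_cons, List.length_nil, zero_add] at this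
      rw [this, Pi.add_apply, Pi.single_apply]
      simp only [Fin.ext_iff]
    have e2 : (fun k : Fin N => (p ++ (a + 1) :: a :: q).getD k 0) =
        (fun k : Fin N => (p ++ a :: a :: q).getD k 0) +
          Pi.single (⟨p.length, by omega⟩ : Fin N) 1 := by
      funext k
      rw [getD_bump p (a :: q) a 1 k, Pi.add_apply, Pi.single_apply]
      simp only [Fin.ext_iff]
    rw [e1, e2, key]
  · rw [mul_zero]

/-- The generating function `∏ (1 - x_i X)` of the elementary symmetric functions of `x`, with
signs. -/
noncomputable def elemSeries (x : Fin N → F) : PowerSeries F :=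
  ∏ i, (1 - PowerSeries.C (x i) * PowerSeries.X)

/-- The elementary symmetric function `e_m` of `x`, times `(-1) ^ m`. -/
noncomputable def signedElem (m : ℕ) (x : Fin N → F) : F := PowerSeries.coeff m (elemSeries x)

theorem zipWith_prod_eq (y : Fin N → F) (l : List ℕ) (hl : l.length = N) :
    (List.zipWith (fun z a => z ^ a) (List.ofFn y) l).prod = ∏ i, y i ^ l.getD i 0 := by
  rw [← List.prod_ofFn]
  congr 1
  refine List.ext_getElem (by simp [hl]) fun i h1 h2 => ?_
  simp only [List.length_ofFn] at h2
  simp [hl]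

theorem elemSeries_mul_hlList (t : F) (x : Fin N → F) (l : List ℕ) (hl : l.length = N) :
    elemSeries x * PowerSeries.C (hlList t x l) =
      bumpSum (-PowerSeries.X) l fun s => PowerSeries.C (hlList t x s) := by
  let Y : Equiv.Perm (Fin N) → List (PowerSeries F) := fun w =>
    List.ofFn fun i => PowerSeries.C (x (w i))
  have h1 : ∀ s : List ℕ, s.length = l.length → PowerSeries.C (hlList t x s) =
      ∑ w : Equiv.Perm (Fin N), PowerSeries.C (hlKernel t x w) *
        (List.zipWith (fun z a => z ^ a) (Y w) s).prod := by
    intro s hs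
    rw [hlList, if_pos (hs.trans hl), hlSum, map_sum]
    refine sum_congr rfl fun w _ => ?_
    have h2 : Y w = (List.ofFn fun i => x (w i)).map PowerSeries.C := by
      rw [List.map_ofFn]; rfl
    have h3 : (List.zipWith (fun z a => z ^ a) (Y w) s).prod =
        PowerSeries.C (List.zipWith (fun z a => z ^ a) (List.ofFn fun i => x (w i)) s).prod := by
      rw [h2, List.zipWith_map_left, map_list_prod, List.map_zipWith]
      simp
    rw [h3, zipWith_prod_eq _ _ (hs.trans hl), map_mul, mul_comm]
  rw [bumpSum_congr _ _ h1, bumpSum_sum, h1 l rfl, mul_sum]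
  refine sum_congr rfl fun w _ => ?_
  rw [bumpSum_mul, bumpSum_monomial _ _ _ (by simp [Y, hl])]
  have h4 : ((Y w).map fun z => 1 + -PowerSeries.X * z).prod = elemSeries x := by
    rw [List.map_ofFn, List.prod_ofFn, elemSeries]
    refine Fintype.prod_equiv w _ _ fun i => ?_
    simp only [Function.comp]
    ring
  rw [h4]; ring

/-- The number of the first `N` parts of `μ` that are at least `k`. -/
def cumul (N : ℕ) (μ : YoungDiagram) : ℕ → ℕ
  | 0 => N
  | k + 1 => μ.colLen k

theorem cumul_antitone {μ : YoungDiagram} (h : μ.colLen 0 ≤ N) : Antitone (cumul N μ) := by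
  refine antitone_nat_of_succ_le fun k => ?_
  cases k with
  | zero => exact h
  | succ k => exact μ.colLen_anti _ _ (Nat.le_succ k)

theorem lt_cumul_iff {μ : YoungDiagram} {i k : ℕ} (hi : i < N) :
    i < cumul N μ k ↔ k ≤ μ.rowLen i := by
  cases k with
  | zero => simp [cumul, hi]
  | succ k => rw [cumul, Nat.succ_le_iff, lt_rowLen_iff_lt_colLen]

/-- The multiplicity of `k` among the first `N` parts of `μ`. -/
def mult (N : ℕ) (μ : YoungDiagram) (k : ℕ) : ℕ := cumul N μ k - cumul N μ (k + 1)

theorem card_filter_rowLen {μ : YoungDiagram} (h : μ.colLen 0 ≤ N) (k : ℕ) :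
    #{i : Fin N | μ.rowLen i = k} = mult N μ k := by
  rw [mult, ← Nat.card_Ico, ← card_map Fin.valEmbedding]
  congr 1
  ext i
  simp only [mem_map, mem_filter, mem_univ, true_and, Fin.valEmbedding_apply, mem_Ico]
  constructor
  · rintro ⟨i, hi, rfl⟩
    rw [lt_cumul_iff i.2, ← not_lt, lt_cumul_iff i.2]
    omega
  · rintro ⟨h1, h2⟩
    have hN : i < N := h2.trans_le (cumul_antitone h (Nat.zero_le k))
    refine ⟨⟨i, hN⟩, ?_, rfl⟩
    rw [lt_cumul_iff hN] at h2
    rw [← not_lt, lt_cumul_iff hN] at h1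
    simp only
    omega

theorem vPoly_eq {μ : YoungDiagram} (h : μ.colLen 0 ≤ N) {K : ℕ} (hK : μ.rowLen 0 < K) :
    vPoly N μ = ∏ k ∈ range K, vFactor (mult N μ k) := by
  rw [vPoly]
  simp_rw [card_filter_rowLen h]
  refine prod_subset (range_subset_range.2 hK) fun k _ hk => ?_
  rw [mem_range, not_lt] at hk
  obtain ⟨k, rfl⟩ : ∃ j, k = j + 1 := ⟨k - 1, by omega⟩
  rw [mult, cumul, colLen_eq_zero_iff.2 (by omega), Nat.zero_sub, vFactor_zero]

theorem blockList_mult {μ : YoungDiagram} (h : μ.colLen 0 ≤ N) {K : ℕ} (hK : μ.rowLen 0 < K) :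
    (blockList (mult N μ) K).length = N ∧
      ∀ i < N, (blockList (mult N μ) K).getD i 0 = μ.rowLen i := by
  have hcK : cumul N μ K = 0 := by
    obtain ⟨k, rfl⟩ : ∃ j, K = j + 1 := ⟨K - 1, by omega⟩
    exact colLen_eq_zero_iff.2 (by omega)
  obtain ⟨h1, h2⟩ := blockList_spec (cumul N μ) (cumul_antitone h) K
  rw [hcK] at h1 h2
  refine ⟨h1, fun i hi => (h2 i hi).trans ?_⟩
  have : {k ∈ range K | 1 ≤ k ∧ i + 0 < cumul N μ k} = Icc 1 (μ.rowLen i) := by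
    ext k
    simp only [mem_filter, mem_range, mem_Icc, add_zero]
    rw [lt_cumul_iff hi]
    have := μ.rowLen_anti 0 i (Nat.zero_le i)
    omega
  rw [this, Nat.card_Icc, Nat.add_sub_cancel]

theorem hlList_blockList (t : F) (x : Fin N → F) {μ : YoungDiagram} (h : μ.colLen 0 ≤ N) {K : ℕ}
    (hK : μ.rowLen 0 < K) :
    hlList t x (blockList (mult N μ) K) = hlSum t x fun i => μ.rowLen i := by
  obtain ⟨h1, h2⟩ := blockList_mult h hK
  rw [hlList, if_pos h1]
  congr 1
  funext i
  exact h2 i i.2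

end Field

section Field

variable {F : Type*} [Field F] {N : ℕ}

theorem exists_bump (μ : YoungDiagram) {K : ℕ}
    {r : Fin K → ℕ} (hr : ∀ k : Fin K, r k ≤ mult N μ k) :
    ∃ ν : YoungDiagram, ∀ j, ν.colLen j = μ.colLen j + extendZero r j := by
  have hr' : ∀ k, extendZero r k ≤ mult N μ k := by
    intro k
    by_cases hk : k < K
    · simpa [extendZero, hk] using hr ⟨k, hk⟩
    · rw [extendZero_of_le r (not_lt.1 hk)]; exact Nat.zero_le _
  refine exists_colLen_eq _ (antitone_nat_of_succ_le fun k => ?_) (K + μ.rowLen 0) ?_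
  · have h1 := hr' (k + 1)
    have h2 := μ.colLen_anti k (k + 1) (Nat.le_succ k)
    simp only [mult, cumul] at h1
    omega
  · rw [extendZero_of_le r (Nat.le_add_right K _), colLen_eq_zero_iff.2 (Nat.le_add_left _ _)]

theorem bumpedMult_eq {μ ν : YoungDiagram} {r : ℕ → ℕ}
    (hr : ∀ k, r k ≤ mult N μ k) (hν : ∀ j, ν.colLen j = μ.colLen j + r j) :
    bumpedMult (mult N μ) r = mult N ν := by
  funext k
  cases k with
  | zero =>
    have := hr 0
    simp only [bumpedMult, mult, cumul, hν] at *
    omega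
  | succ k =>
    have h1 := hr (k + 1)
    have h2 := μ.colLen_anti k (k + 1) (Nat.le_succ k)
    simp only [bumpedMult, mult, cumul, hν] at *
    omega

open Classical in
/-- The coefficient of `P_λ` in `e_m P_μ`, for `|λ| = |μ| + m`, as a product over the columns. It
vanishes unless `λ / μ` is a vertical strip. -/
noncomputable def vStrip (lam μ : YoungDiagram) : ℤ[X] :=
  if μ ≤ lam then ∏ i ∈ range (lam.rowLen 0),
    gauss (lam.colLen i - lam.colLen (i + 1)) (lam.colLen i - μ.colLen i) else 0

theorem vStrip_eq {lam μ : YoungDiagram} (h : μ ≤ lam) {M : ℕ} (hM : lam.rowLen 0 ≤ M) :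
    vStrip lam μ = ∏ i ∈ range M,
      gauss (lam.colLen i - lam.colLen (i + 1)) (lam.colLen i - μ.colLen i) := by
  rw [vStrip, if_pos h]
  refine prod_subset (range_subset_range.2 hM) fun k _ hk => ?_
  rw [mem_range, not_lt] at hk
  rw [colLen_eq_zero_iff.2 hk]
  simp

theorem vStrip_ne_zero {lam μ : YoungDiagram} (h : vStrip lam μ ≠ 0) :
    μ ≤ lam ∧ ∀ i, lam.colLen (i + 1) ≤ μ.colLen i := by
  have hle : μ ≤ lam := by
    by_contra hle
    exact h (by rw [vStrip, if_neg hle])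
  refine ⟨hle, fun i => ?_⟩
  by_contra! hi
  refine h ?_
  rw [vStrip_eq hle (le_max_left _ (i + 1))]
  refine prod_eq_zero (mem_range.2 (lt_of_lt_of_le (Nat.lt_succ_self i) (le_max_right _ _))) ?_
  refine gauss_eq_zero ?_
  have := lam.colLen_anti i (i + 1) (Nat.le_succ i)
  have := colLen_le_of_le hle i
  omega

/-- The passage from the Gaussian binomials produced by sorting to the Pieri coefficients. -/
theorem vPoly_mul_prod_gauss {μ ν : YoungDiagram} (h : μ.colLen 0 ≤ N) {r : ℕ → ℕ}
    (hr : ∀ k, r k ≤ mult N μ k) (hν : ∀ j, ν.colLen j = μ.colLen j + r j) {K : ℕ}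
    (hK : μ.rowLen 0 < K) :
    vPoly N ν * ∏ k ∈ range K, gauss (mult N μ k) (r k) = vPoly N μ * vStrip ν μ := by
  have hνN : ν.colLen 0 ≤ N := by
    have := hr 0
    simp only [mult, cumul] at this
    rw [hν]; omega
  have hle : μ ≤ ν := le_iff_colLen.2 fun j => by rw [hν]; omega
  have hνK : ν.rowLen 0 ≤ K := by
    rw [← colLen_eq_zero_iff, hν]
    obtain ⟨k, rfl⟩ : ∃ j, K = j + 1 := ⟨K - 1, by omega⟩
    have := hr (k + 1)
    have h0 : μ.colLen k = 0 := colLen_eq_zero_iff.2 (by omega)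
    have h1 : μ.colLen (k + 1) = 0 := colLen_eq_zero_iff.2 (by omega)
    simp only [mult, cumul, h0] at this
    omega
  have hmult : ∀ k, mult N ν (k + 1) = ν.colLen k - ν.colLen (k + 1) := fun k => rfl
  have hrK : r K = 0 := by
    have h0 := colLen_eq_zero_iff.2 hνK
    rw [hν] at h0
    omega
  rw [vPoly_eq hνN (Nat.lt_succ_of_le hνK), vPoly_eq h hK, vStrip_eq hle hνK]
  have hb := bumpedMult_eq hr hν
  have h1 : ∀ k, vFactor (mult N ν (k + 1)) =
      gauss (ν.colLen k - ν.colLen (k + 1)) (ν.colLen k - μ.colLen k) *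
        (vFactor (r k) * vFactor (mult N μ (k + 1) - r (k + 1))) := by
    intro k
    have h2 : mult N ν (k + 1) = mult N μ (k + 1) - r (k + 1) + r k := by rw [← hb]; rfl
    have h3 : ν.colLen k - μ.colLen k = r k := by rw [hν]; omega
    rw [← hmult, h3, h2]
    exact (gauss_mul_vFactor _ _).symm
  have h0 : vFactor (mult N ν 0) = vFactor (mult N μ 0 - r 0) := by rw [← hb]; rfl
  rw [Nat.succ_eq_add_one, prod_range_succ', h0, prod_congr rfl fun k _ => h1 k, prod_mul_distrib,
    prod_mul_distrib]
  have h4 : (∏ k ∈ range K, vFactor (mult N μ (k + 1) - r (k + 1))) * vFactor (mult N μ 0 - r 0) =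
      ∏ k ∈ range K, vFactor (mult N μ k - r k) := by
    rw [← prod_range_succ' (fun k => vFactor (mult N μ k - r k)), prod_range_succ]
    have : mult N μ K = 0 := by
      obtain ⟨k, rfl⟩ : ∃ j, K = j + 1 := ⟨K - 1, by omega⟩
      rw [mult, cumul, colLen_eq_zero_iff.2 (by omega), Nat.zero_sub]
    rw [this, Nat.zero_sub, vFactor_zero, mul_one]
  have h5 : ∏ k ∈ range K, vFactor (mult N μ k) = (∏ k ∈ range K, gauss (mult N μ k) (r k)) *
      ((∏ k ∈ range K, vFactor (r k)) * ∏ k ∈ range K, vFactor (mult N μ k - r k)) := by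
    rw [← prod_mul_distrib, ← prod_mul_distrib]
    exact prod_congr rfl fun k _ => (gauss_mul_vFactor' (hr k)).symm
  rw [h5, ← h4]
  ring

/-- The Hall–Littlewood polynomial `P_μ(x; t)` at a point `x` and a parameter `t` of a field, zero
if `μ` has more than `N` parts. It is meaningful if the `x_i` are distinct and the `v_m(t)` do not
vanish. -/
noncomputable def hlP (t : F) (x : Fin N → F) (μ : YoungDiagram) : F :=
  if μ.colLen 0 ≤ N then (evalAt t (vPoly N μ))⁻¹ * hlSum t x fun i => μ.rowLen i else 0

theorem signedElem_mul_hlSum (t : F) {x : Fin N → F} (hx : Function.Injective x)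
    {μ : YoungDiagram} (h : μ.colLen 0 ≤ N) {K : ℕ} (hK : μ.rowLen 0 < K) (m : ℕ) :
    signedElem m x * (hlSum t x fun i => μ.rowLen i) =
      ∑ r ∈ Fintype.piFinset fun k : Fin K => range (mult N μ k + 1),
        if ∑ k, r k = m then
          (-1) ^ m * evalAt t (∏ k ∈ range K, gauss (mult N μ k) (extendZero r k)) *
            hlList t x (bumpedList (mult N μ) (extendZero r) K)
        else 0 := by
  have h1 := elemSeries_mul_hlList t x _ (blockList_mult h hK).1
  have h2 : Straightens (PowerSeries.C t) fun s => PowerSeries.C (hlList t x s) := by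
    intro p q a
    simp only
    rw [straightens_hlList t hx p q a, map_mul]
  rw [bumpSum_blockList h2, hlList_blockList t x h hK] at h1
  have h3 := congrArg (PowerSeries.coeff m) h1
  rw [PowerSeries.coeff_mul_C, map_sum] at h3
  rw [signedElem, h3]
  refine sum_congr rfl fun r _ => ?_
  have h4 : (∏ k : Fin K, ((-PowerSeries.X) ^ r k *
      evalAt (PowerSeries.C t) (gauss (mult N μ k) (r k)))) =
      PowerSeries.C ((-1) ^ (∑ k, r k) *
        evalAt t (∏ k ∈ range K, gauss (mult N μ k) (extendZero r k))) *
        PowerSeries.X ^ (∑ k, r k) := by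
    rw [prod_mul_distrib, prod_pow_eq_pow_sum, neg_pow, map_mul, map_evalAt, map_prod,
      prod_range]
    simp only [extendZero_val, map_pow, map_neg, map_one]
    ring
  rw [h4, PowerSeries.coeff_mul_C, PowerSeries.coeff_C_mul_X_pow]
  by_cases hm : m = ∑ k, r k
  · rw [if_pos hm, if_pos hm.symm, ← hm]
  · rw [if_neg hm, if_neg (Ne.symm hm), zero_mul]

open Classical in
/-- The Pieri formula for elementary symmetric functions. The coefficients do not depend on the
number of variables. -/
theorem signedElem_mul_hlP {t : F} (ht : ∀ m, evalAt t (vFactor m) ≠ 0) {x : Fin N → F}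
    (hx : Function.Injective x) (μ : YoungDiagram) (m : ℕ) :
    signedElem m x * hlP t x μ = ∑ ν ∈ partitionsOf (μ.card + m),
      (-1) ^ m * evalAt t (vStrip ν μ) * hlP t x ν := by
  have hv : ∀ ν, evalAt t (vPoly N ν) ≠ 0 := by
    intro ν
    rw [vPoly, map_prod]
    exact prod_ne_zero_iff.2 fun _ _ => ht _
  by_cases h : μ.colLen 0 ≤ N
  swap
  · rw [hlP, if_neg h, mul_zero, eq_comm]
    refine sum_eq_zero fun ν _ => ?_
    by_cases hle : μ ≤ ν
    · rw [hlP, if_neg, mul_zero]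
      exact fun h' => h ((colLen_le_of_le hle 0).trans h')
    · rw [vStrip, if_neg hle]; simp
  set K := μ.rowLen 0 + 1 with hKdef
  have hK : μ.rowLen 0 < K := Nat.lt_succ_self _
  have hmK : mult N μ K = 0 := by
    rw [hKdef, mult, cumul, colLen_eq_zero_iff.2 le_rfl, Nat.zero_sub]
  rw [hlP, if_pos h, mul_left_comm, signedElem_mul_hlSum t hx h hK, mul_sum]
  let S : Finset YoungDiagram := {ν ∈ partitionsOf (μ.card + m) |
    μ ≤ ν ∧ ν.colLen 0 ≤ N ∧ ∀ i, ν.colLen (i + 1) ≤ μ.colLen i}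
  have hS : ∑ ν ∈ partitionsOf (μ.card + m), (-1) ^ m * evalAt t (vStrip ν μ) * hlP t x ν =
      ∑ ν ∈ S, (-1) ^ m * evalAt t (vStrip ν μ) * hlP t x ν := by
    refine (sum_filter_of_ne fun ν _ hne => ?_).symm
    have h1 : vStrip ν μ ≠ 0 := fun h0 => hne (by rw [h0]; simp)
    refine ⟨(vStrip_ne_zero h1).1, ?_, (vStrip_ne_zero h1).2⟩
    by_contra h0
    exact hne (by rw [hlP, if_neg h0, mul_zero])
  have hL : ∀ g : (Fin K → ℕ) → F,
      ∑ r ∈ Fintype.piFinset fun k : Fin K => range (mult N μ k + 1),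
        (evalAt t (vPoly N μ))⁻¹ * (if ∑ k, r k = m then g r else 0) =
      ∑ r ∈ (Fintype.piFinset fun k : Fin K => range (mult N μ k + 1)) with ∑ k, r k = m,
        (evalAt t (vPoly N μ))⁻¹ * g r := by
    intro g
    rw [sum_filter]
    exact sum_congr rfl fun r _ => by split_ifs <;> simp
  rw [hS, hL]
  have hSK : ∀ ν ∈ S, ν.rowLen 0 ≤ K := by
    intro ν hν
    have := (mem_filter.1 hν).2.2.2 (μ.rowLen 0)
    rw [colLen_eq_zero_iff.2 le_rfl] at this
    exact colLen_eq_zero_iff.1 (Nat.le_zero.1 this)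
  have hSr : ∀ ν ∈ S, ∀ j, ν.colLen j =
      μ.colLen j + extendZero (fun k : Fin K => ν.colLen k - μ.colLen k) j := by
    intro ν hν j
    have h1 := colLen_le_of_le (mem_filter.1 hν).2.1 j
    by_cases hj : j < K
    · simp only [extendZero, hj, dif_pos]; omega
    · have h2 := colLen_eq_zero_iff.2 ((hSK ν hν).trans (not_lt.1 hj))
      rw [extendZero_of_le _ (not_lt.1 hj)]; omega
  symm
  refine sum_bij (fun ν _ => fun k : Fin K => ν.colLen k - μ.colLen k) ?_ ?_ ?_ ?_
  · intro ν hν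
    have h1 := (mem_filter.1 hν).2
    rw [mem_filter, Fintype.mem_piFinset]
    constructor
    · intro k
      rw [mem_range, Nat.lt_succ_iff, mult]
      cases hk : (k : ℕ) with
      | zero => simp only [cumul]; have := h1.2.1; omega
      | succ j => simp only [cumul]; have := h1.2.2 j; omega
    · have h2 := mem_partitionsOf.1 (mem_filter.1 hν).1
      rw [card_eq_sum_colLen ν (hSK ν hν), card_eq_sum_colLen μ hK.le] at h2
      rw [Fin.sum_univ_eq_sum_range (fun k => ν.colLen k - μ.colLen k)]
      rw [sum_tsub_distrib _ fun k _ => colLen_le_of_le h1.1 k]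
      omega
  · intro ν hν ν' hν' heq
    refine ext_colLen fun j => ?_
    rw [hSr ν hν, hSr ν' hν', heq]
  · intro r hr
    rw [mem_filter, Fintype.mem_piFinset] at hr
    have hr' : ∀ k : Fin K, r k ≤ mult N μ k := fun k => Nat.lt_succ_iff.1 (mem_range.1 (hr.1 k))
    obtain ⟨ν, hν⟩ := exists_bump μ hr'
    have hle : μ ≤ ν := le_iff_colLen.2 fun j => by rw [hν]; omega
    have hνK : ν.rowLen 0 ≤ K := by
      rw [← colLen_eq_zero_iff, hν, extendZero_of_le _ le_rfl]
      exact colLen_eq_zero_iff.2 hK.le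
    refine ⟨ν, ?_, ?_⟩
    · simp only [S, mem_filter, mem_partitionsOf]
      refine ⟨?_, hle, ?_, fun i => ?_⟩
      · rw [card_eq_sum_colLen ν hνK, card_eq_sum_colLen μ hK.le, ← hr.2,
          ← Fin.sum_univ_eq_sum_range, ← Fin.sum_univ_eq_sum_range, ← sum_add_distrib]
        exact sum_congr rfl fun k _ => by rw [hν, extendZero_val]
      · have := hr' ⟨0, Nat.succ_pos _⟩
        have h2 := extendZero_val r ⟨0, Nat.succ_pos _⟩
        simp only [mult, cumul] at this h2
        rw [hν, h2]; omega
      · by_cases hi : i + 1 < K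
        · have := hr' ⟨i + 1, hi⟩
          have h2 := extendZero_val r ⟨i + 1, hi⟩
          have h3 := μ.colLen_anti i (i + 1) (Nat.le_succ i)
          simp only [mult, cumul] at this h2
          rw [hν, h2]; omega
        · rw [hν, extendZero_of_le _ (not_lt.1 hi), add_zero]
          exact μ.colLen_anti i (i + 1) (Nat.le_succ i)
    · funext k
      rw [hν, extendZero_val, Nat.add_sub_cancel_left]
  · intro ν hν
    have h1 := (mem_filter.1 hν).2
    set r : Fin K → ℕ := fun k => ν.colLen k - μ.colLen k with hrdef
    have hr : ∀ k, extendZero r k ≤ mult N μ k := by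
      intro k
      by_cases hk : k < K
      · simp only [extendZero, hk, dif_pos, hrdef, mult]
        cases k with
        | zero => simp only [cumul]; have := h1.2.1; omega
        | succ j => simp only [cumul]; have := h1.2.2 j; omega
      · rw [extendZero_of_le r (not_lt.1 hk)]; exact Nat.zero_le _
    have key := congrArg (evalAt t) (vPoly_mul_prod_gauss h hr (hSr ν hν) hK)
    rw [map_mul, map_mul] at key
    have hlist : hlList t x (bumpedList (mult N μ) (extendZero r) K) =
        hlSum t x fun i => ν.rowLen i := by
      rw [bumpedList_eq _ _ _ hmK, bumpedMult_eq hr (hSr ν hν),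
        hlList_blockList t x h1.2.1 (Nat.lt_succ_of_le (hSK ν hν))]
    rw [hlist, hlP, if_pos h1.2.1]
    have h5 := hv μ
    have h6 := hv ν
    field_simp
    rw [mul_comm (evalAt t (vPoly N ν)), mul_comm (evalAt t (vPoly N μ))] at key
    linear_combination (-(hlSum t x fun i => ν.rowLen i)) * key

end Field

/-! ### The Pieri formula for complete symmetric functions -/

open Classical in
/-- The coefficient of `P_ν` in `h_r P_μ`, for `|ν| = |μ| + r`, as a product over the columns. -/
noncomputable def hStrip (ν μ : YoungDiagram) : ℤ[X] :=
  if μ ≤ ν then ∏ i ∈ range (ν.rowLen 0), (X ^ (ν.colLen i - μ.colLen i).choose 2 *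
    gauss (ν.colLen i - μ.colLen (i + 1)) (μ.colLen i - μ.colLen (i + 1))) else 0

theorem hStrip_eq {ν μ : YoungDiagram} (h : μ ≤ ν) {M : ℕ} (hM : ν.rowLen 0 ≤ M) :
    hStrip ν μ = ∏ i ∈ range M, (X ^ (ν.colLen i - μ.colLen i).choose 2 *
      gauss (ν.colLen i - μ.colLen (i + 1)) (μ.colLen i - μ.colLen (i + 1))) := by
  rw [hStrip, if_pos h]
  refine prod_subset (range_subset_range.2 hM) fun k _ hk => ?_
  rw [mem_range, not_lt] at hk
  have h1 : ν.colLen k = 0 := colLen_eq_zero_iff.2 hk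
  have h2 := colLen_le_of_le h k
  have h3 : μ.colLen k = 0 := by omega
  simp [h1, h3]

theorem le_of_hStrip_ne_zero {ν μ : YoungDiagram} (h : hStrip ν μ ≠ 0) : μ ≤ ν := by
  by_contra hle
  exact h (by rw [hStrip, if_neg hle])

/-- The vanishing of the contribution of one column to the product of the two Pieri matrices. After
trinomial revision, the sum is a multiple of the alternating sum of `q`-binomial coefficients in
`sum_neg_one_pow_mul_gauss`. -/
theorem sum_column_eq_zero {e a c : ℕ} (hea : e ≤ a) (hac : a < c) :
    ∑ b ∈ Icc e c, (-1) ^ (c - b) * gauss (c - e) (c - b) *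
      (X ^ (b - a).choose 2 * gauss (b - e) (a - e)) = 0 := by
  obtain ⟨s, rfl⟩ := Nat.exists_eq_add_of_le hea
  obtain ⟨n, rfl⟩ := Nat.exists_eq_add_of_lt hac
  have h1 : ∑ b ∈ Icc e (e + s + n + 1), (-1) ^ (e + s + n + 1 - b) *
        gauss (e + s + n + 1 - e) (e + s + n + 1 - b) *
          (X ^ (b - (e + s)).choose 2 * gauss (b - e) (e + s - e)) =
      ∑ b ∈ Icc (e + s) (e + s + n + 1), (-1) ^ (e + s + n + 1 - b) *
        gauss (e + s + n + 1 - e) (e + s + n + 1 - b) *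
          (X ^ (b - (e + s)).choose 2 * gauss (b - e) (e + s - e)) := by
    refine (sum_subset (Icc_subset_Icc_left (Nat.le_add_right e s)) fun b hb hb' => ?_).symm
    rw [mem_Icc] at hb hb'
    rw [gauss_eq_zero (show b - e < e + s - e by omega)]
    ring
  have h2 : ∑ i ∈ range (n + 2), (-1) ^ i * gauss (n + 1) i * X ^ i.choose 2 *
        ((-1) ^ (n + 1) * gauss (s + n + 1) s) =
      ∑ b ∈ Icc (e + s) (e + s + n + 1), (-1) ^ (e + s + n + 1 - b) *
        gauss (e + s + n + 1 - e) (e + s + n + 1 - b) *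
          (X ^ (b - (e + s)).choose 2 * gauss (b - e) (e + s - e)) := by
    rw [← Ico_add_one_right_eq_Icc, sum_Ico_eq_sum_range,
      show e + s + n + 1 + 1 - (e + s) = n + 2 by omega]
    refine sum_congr rfl fun i hi => ?_
    have hi' := mem_range.1 hi
    obtain ⟨j, hj⟩ := Nat.exists_eq_add_of_le (show i ≤ n + 1 by omega)
    rw [show e + s + n + 1 - (e + s + i) = (s + n + 1) - (s + i) by omega,
      show e + s + n + 1 - e = s + n + 1 by omega, show e + s + i - (e + s) = i by omega,
      show e + s + i - e = s + i by omega, show e + s - e = s by omega,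
      gauss_symm (show s + i ≤ s + n + 1 by omega)]
    have h3 := gauss_mul_gauss (show s + i ≤ s + n + 1 by omega) (Nat.le_add_right s i)
    rw [show s + n + 1 - s = n + 1 by omega, show s + i - s = i by omega] at h3
    have h4 : (-1 : ℤ[X]) ^ i * (-1) ^ (n + 1) = (-1) ^ (s + n + 1 - (s + i)) := by
      rw [show s + n + 1 - (s + i) = j by omega, hj, pow_add, ← mul_assoc, ← mul_pow]
      simp
    rw [← h4]
    linear_combination (-(-1) ^ i * (-1) ^ (n + 1) * X ^ i.choose 2) * h3
  rw [h1, ← h2, ← sum_mul, sum_neg_one_pow_mul_gauss, zero_mul]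

/-- If `μ ⊊ λ`, some column of `λ / μ` is nonempty while the next one is empty. -/
theorem exists_last_column {lam μ : YoungDiagram} (hle : μ ≤ lam) (hne : lam ≠ μ) :
    ∃ i, lam.colLen (i + 1) = μ.colLen (i + 1) ∧ μ.colLen i < lam.colLen i := by
  by_contra! hcon
  refine hne (ext_colLen ?_)
  have h0 : ∀ j, lam.rowLen 0 ≤ j → lam.colLen j = μ.colLen j := by
    intro j hj
    have h1 := colLen_eq_zero_iff.2 hj
    have h2 := colLen_le_of_le hle j
    omega
  have h1 : ∀ k j, lam.rowLen 0 ≤ j + k → lam.colLen j = μ.colLen j := by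
    intro k
    induction k with
    | zero => exact h0
    | succ k ih =>
      intro j hj
      exact le_antisymm (hcon j (ih (j + 1) (by omega))) (colLen_le_of_le hle j)
  exact fun j => h1 (lam.rowLen 0) j (Nat.le_add_left _ _)

open Classical in
/-- The two Pieri matrices are inverse to each other up to signs. The sum over the intermediate
diagram factorizes over the columns, and one column contributes zero if `λ ≠ μ`. -/
theorem sum_vStrip_mul_hStrip {lam μ : YoungDiagram} (B : Finset YoungDiagram)
    (hB : ∀ ν, μ ≤ ν → ν ≤ lam → ν ∈ B) :
    ∑ ν ∈ B, (-1) ^ (lam.card - ν.card) * vStrip lam ν * hStrip ν μ =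
      if lam = μ then 1 else 0 := by
  by_cases hle : μ ≤ lam
  swap
  · rw [if_neg fun h => hle (by rw [h])]
    refine sum_eq_zero fun ν _ => ?_
    by_contra h0
    have h1 : vStrip lam ν ≠ 0 := fun h => h0 (by rw [h]; ring)
    have h2 : hStrip ν μ ≠ 0 := fun h => h0 (by rw [h]; ring)
    exact hle ((le_of_hStrip_ne_zero h2).trans (vStrip_ne_zero h1).1)
  split_ifs with heq
  · subst heq
    rw [sum_eq_single_of_mem lam (hB _ le_rfl le_rfl)]
    · rw [vStrip_eq le_rfl le_rfl, hStrip_eq le_rfl le_rfl]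
      simp
    · intro ν _ hν
      by_contra h0
      have h1 : vStrip lam ν ≠ 0 := fun h => h0 (by rw [h]; ring)
      have h2 : hStrip ν lam ≠ 0 := fun h => h0 (by rw [h]; ring)
      exact hν (le_antisymm (vStrip_ne_zero h1).1 (le_of_hStrip_ne_zero h2))
  set M := lam.rowLen 0 with hM
  -- The contribution of column `i` when the intermediate diagram has `b` boxes in that column.
  let term : ℕ → ℕ → ℤ[X] := fun i b =>
    (-1) ^ (lam.colLen i - b) *
      gauss (lam.colLen i - lam.colLen (i + 1)) (lam.colLen i - b) *
      (X ^ (b - μ.colLen i).choose 2 * gauss (b - μ.colLen (i + 1))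
        (μ.colLen i - μ.colLen (i + 1)))
  obtain ⟨i, hi1, hi2⟩ := exists_last_column hle heq
  have hiM : i < M := by
    by_contra! h
    have := colLen_eq_zero_iff.2 h
    omega
  have hzero : ∑ b ∈ Fintype.piFinset fun k : Fin M => Icc (lam.colLen (k + 1)) (lam.colLen k),
      ∏ k : Fin M, term k (b k) = 0 := by
    rw [← prod_univ_sum (fun k : Fin M => Icc (lam.colLen (k + 1)) (lam.colLen k))
      fun k b => term k b]
    refine prod_eq_zero (mem_univ ⟨i, hiM⟩) ?_
    have := sum_column_eq_zero (μ.colLen_anti i (i + 1) (Nat.le_succ i)) hi2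
    simp only [term, hi1]
    exact this
  rw [← hzero]
  refine sum_bij_ne_zero (fun ν _ _ => fun k : Fin M => ν.colLen k) ?_ ?_ ?_ ?_
  · intro ν _ hne
    have h1 : vStrip lam ν ≠ 0 := fun h => hne (by rw [h]; ring)
    rw [Fintype.mem_piFinset]
    exact fun k => mem_Icc.2 ⟨(vStrip_ne_zero h1).2 k, colLen_le_of_le (vStrip_ne_zero h1).1 k⟩
  · intro ν _ hne ν' _ hne' h
    have h1 : vStrip lam ν ≠ 0 := fun h => hne (by rw [h]; ring)
    have h1' : vStrip lam ν' ≠ 0 := fun h => hne' (by rw [h]; ring)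
    refine ext_colLen fun j => ?_
    by_cases hj : j < M
    · exact congrFun h ⟨j, hj⟩
    · have h2 := colLen_eq_zero_iff.2 (not_lt.1 hj)
      have h3 := colLen_le_of_le (vStrip_ne_zero h1).1 j
      have h3' := colLen_le_of_le (vStrip_ne_zero h1').1 j
      omega
  · intro b hb hne
    rw [Fintype.mem_piFinset] at hb
    have hb' : ∀ k : Fin M, lam.colLen (k + 1) ≤ b k ∧ b k ≤ lam.colLen k := fun k =>
      mem_Icc.1 (hb k)
    obtain ⟨ν, hν⟩ := exists_colLen_eq (extendZero b)
      (antitone_nat_of_succ_le fun k => by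
        by_cases hk : k + 1 < M
        · have h1 := (hb' ⟨k + 1, hk⟩).2
          have h2 := (hb' ⟨k, by omega⟩).1
          have e1 := extendZero_val b ⟨k + 1, hk⟩
          have e2 := extendZero_val b ⟨k, by omega⟩
          simp only at *
          omega
        · rw [extendZero_of_le b (not_lt.1 hk)]
          exact Nat.zero_le _) M (extendZero_of_le b le_rfl)
    have hνb : ∀ k : Fin M, ν.colLen k = b k := fun k => by rw [hν, extendZero_val]
    have hνlam : ν ≤ lam := by
      refine le_iff_colLen.2 fun j => ?_
      by_cases hj : j < M
      · exact (hνb ⟨j, hj⟩).le.trans (hb' ⟨j, hj⟩).2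
      · rw [hν, extendZero_of_le b (not_lt.1 hj)]; exact Nat.zero_le _
    have hμν : μ ≤ ν := by
      refine le_iff_colLen.2 fun j => ?_
      by_cases hj : j < M
      · rw [hνb ⟨j, hj⟩]
        by_contra! hlt
        refine hne (prod_eq_zero (mem_univ ⟨j, hj⟩) ?_)
        have h1 := (hb' ⟨j, hj⟩).1
        have h2 := colLen_le_of_le hle (j + 1)
        simp only [term]
        simp only at h1 hlt
        rw [gauss_eq_zero (show b ⟨j, hj⟩ - μ.colLen (j + 1) < μ.colLen j - μ.colLen (j + 1) by
          omega)]
        ring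
      · have h1 := colLen_eq_zero_iff.2 (not_lt.1 hj)
        have h2 := colLen_le_of_le hle j
        omega
    have hval : (-1) ^ (lam.card - ν.card) * vStrip lam ν * hStrip ν μ =
        ∏ k : Fin M, term k (ν.colLen k) := by
      have hνM : ν.rowLen 0 ≤ M := by
        rw [← colLen_eq_zero_iff, hν, extendZero_of_le b le_rfl]
      rw [vStrip_eq hνlam le_rfl, hStrip_eq hμν hνM, card_eq_sum_colLen lam le_rfl,
        card_eq_sum_colLen ν hνM, ← sum_tsub_distrib _ fun k _ => colLen_le_of_le hνlam k,
        ← prod_pow_eq_pow_sum, ← prod_mul_distrib, ← prod_mul_distrib, prod_range]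
    refine ⟨ν, hB ν hμν hνlam, ?_, funext hνb⟩
    rw [hval]
    simpa only [hνb] using hne
  · intro ν _ hne
    have h1 : vStrip lam ν ≠ 0 := fun h => hne (by rw [h]; ring)
    have h2 : hStrip ν μ ≠ 0 := fun h => hne (by rw [h]; ring)
    have hνlam := (vStrip_ne_zero h1).1
    have hνM : ν.rowLen 0 ≤ M := by
      rw [← colLen_eq_zero_iff]
      have h3 := colLen_le_of_le hνlam M
      have h4 : lam.colLen M = 0 := colLen_eq_zero_iff.2 le_rfl
      omega
    rw [vStrip_eq hνlam le_rfl, hStrip_eq (le_of_hStrip_ne_zero h2) hνM,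
      card_eq_sum_colLen lam le_rfl, card_eq_sum_colLen ν hνM,
      ← sum_tsub_distrib _ fun k _ => colLen_le_of_le hνlam k,
      ← prod_pow_eq_pow_sum, ← prod_mul_distrib, ← prod_mul_distrib, prod_range]

section Field

variable {F : Type*} [Field F] {N : ℕ}

/-- The generating function `∏ 1 / (1 - x_i X)` of the complete symmetric functions of `x`. -/
noncomputable def completeSeries (x : Fin N → F) : PowerSeries F :=
  ∏ i, PowerSeries.mk fun n => x i ^ n

/-- The complete symmetric function `h_r` of `x`. -/
noncomputable def completeSym (r : ℕ) (x : Fin N → F) : F :=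
  PowerSeries.coeff r (completeSeries x)

theorem completeSeries_mul_elemSeries (x : Fin N → F) : completeSeries x * elemSeries x = 1 := by
  rw [completeSeries, elemSeries, ← prod_mul_distrib]
  refine prod_eq_one fun i _ => ?_
  ext n
  rw [mul_sub, mul_one, map_sub, mul_comm (PowerSeries.C (x i)), ← mul_assoc,
    PowerSeries.coeff_mul_C]
  cases n with
  | zero => simp
  | succ n => simp [PowerSeries.coeff_succ_mul_X, PowerSeries.coeff_one, pow_succ]

/-- The Pieri formula for complete symmetric functions, obtained from the one for elementary
symmetric functions by inverting the generating function. -/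
theorem completeSym_mul_hlP {t : F} (ht : ∀ m, evalAt t (vFactor m) ≠ 0) {x : Fin N → F}
    (hx : Function.Injective x) (μ : YoungDiagram) (r : ℕ) :
    completeSym r x * hlP t x μ =
      ∑ ν ∈ partitionsOf (μ.card + r), evalAt t (hStrip ν μ) * hlP t x ν := by
  -- The series `H` is the right-hand side of the claim. It is determined by its product with
  -- `∏ (1 - x_i X)`.
  let H : PowerSeries F := PowerSeries.mk fun r =>
    ∑ ν ∈ partitionsOf (μ.card + r), evalAt t (hStrip ν μ) * hlP t x ν
  classical
  have key : H * elemSeries x = PowerSeries.C (hlP t x μ) := by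
    ext n
    rw [PowerSeries.coeff_mul, Nat.sum_antidiagonal_eq_sum_range_succ_mk]
    have h1 : ∀ k ∈ range (n + 1),
        PowerSeries.coeff k H * PowerSeries.coeff (n - k) (elemSeries x) =
        ∑ lam ∈ partitionsOf (μ.card + n), ∑ ν ∈ partitionsOf (μ.card + k),
          evalAt t ((-1) ^ (lam.card - ν.card) * vStrip lam ν * hStrip ν μ) * hlP t x lam := by
      intro k hk
      have hk' := mem_range.1 hk
      rw [PowerSeries.coeff_mk, sum_mul, sum_comm]
      refine sum_congr rfl fun ν hν => ?_
      rw [mem_partitionsOf] at hν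
      have := signedElem_mul_hlP ht hx ν (n - k)
      rw [hν, show μ.card + k + (n - k) = μ.card + n by omega] at this
      rw [mul_right_comm, mul_assoc, ← signedElem, this, mul_sum]
      refine sum_congr rfl fun lam hlam => ?_
      rw [mem_partitionsOf] at hlam
      rw [hν, hlam, show μ.card + n - (μ.card + k) = n - k by omega]
      simp only [map_mul, map_pow, map_neg, map_one]
      ring
    rw [sum_congr rfl h1, sum_comm]
    have h2 : ∀ lam ∈ partitionsOf (μ.card + n),
        (∑ k ∈ range (n + 1), ∑ ν ∈ partitionsOf (μ.card + k),
          evalAt t ((-1) ^ (lam.card - ν.card) * vStrip lam ν * hStrip ν μ) * hlP t x lam) =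
        if lam = μ then hlP t x lam else 0 := by
      intro lam hlam
      rw [mem_partitionsOf] at hlam
      rw [← sum_biUnion]
      · rw [← sum_mul, ← map_sum, sum_vStrip_mul_hStrip]
        · split_ifs <;> simp
        · intro ν h1 h2
          have h3 := card_le_of_le h1
          have h4 := card_le_of_le h2
          rw [mem_biUnion]
          exact ⟨ν.card - μ.card, mem_range.2 (by omega), mem_partitionsOf.2 (by omega)⟩
      · intro a _ b _ hab
        rw [Function.onFun, disjoint_left]
        intro ν h1 h2
        rw [mem_partitionsOf] at h1 h2
        omega
    rw [sum_congr rfl h2, PowerSeries.coeff_C, sum_ite_eq']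
    simp [mem_partitionsOf]
  have h3 : H = completeSeries x * PowerSeries.C (hlP t x μ) := by
    rw [← key, mul_comm H, ← mul_assoc, completeSeries_mul_elemSeries, one_mul]
  have h4 := congrArg (PowerSeries.coeff r) h3
  rw [PowerSeries.coeff_mul_C, PowerSeries.coeff_mk] at h4
  exact h4.symm

end Field

/-! ### The Hall–Littlewood polynomial of the empty partition -/

section Field

variable {F : Type*} [Field F] {N : ℕ}

theorem prod_erase_eq_prod_ite {ι B : Type*} [Fintype ι] [DecidableEq ι] [CommMonoid B] (i : ι)
    (f : ι → B) : ∏ j ∈ univ.erase i, f j = ∏ j, if j = i then 1 else f j := by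
  rw [← mul_prod_erase univ _ (mem_univ i), if_pos rfl, one_mul]
  exact prod_congr rfl fun j hj => (if_neg (ne_of_mem_erase hj)).symm

/-- A consequence of Lagrange interpolation of `∏ (X - t x_j)` at the points `0, x_1, …, x_N`:
the leading coefficient `1` is expressed through the values at these points. -/
theorem sum_prod_ratio (t : F) {x : Fin N → F} (hx : Function.Injective x) (hx0 : ∀ i, x i ≠ 0) :
    ∑ i, ∏ j ∈ univ.erase i, (x i - t * x j) / (x i - x j) = ∑ k ∈ range N, t ^ k := by
  by_cases ht : t = 1
  · subst ht
    have : ∀ i, ∏ j ∈ univ.erase i, (x i - 1 * x j) / (x i - x j) = 1 := fun i =>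
      prod_eq_one fun j hj => by
        rw [one_mul]
        exact div_self (sub_ne_zero.2 fun h => ne_of_mem_erase hj (hx h).symm)
    rw [sum_congr rfl fun i _ => this i]
    simp
  let v : Fin (N + 1) → F := Fin.cons 0 x
  have hv : Function.Injective v := by
    refine Fin.cons_injective_iff.2 ⟨?_, hx⟩
    rintro ⟨i, hi⟩
    exact hx0 i hi
  let P : F[X] := ∏ j, (X - C (t * x j))
  have hP : P.Monic := monic_prod_of_monic _ _ fun j _ => monic_X_sub_C _
  have hdeg : P.natDegree = N := by
    simp only [P]
    rw [natDegree_prod_of_monic _ _ fun j _ => monic_X_sub_C _]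
    simp only [natDegree_X_sub_C]
    simp
  have key := Lagrange.coeff_eq_sum (s := (univ : Finset (Fin (N + 1)))) hv.injOn (P := P) (by
    rw [degree_eq_natDegree hP.ne_zero, hdeg, card_univ, Fintype.card_fin]
    exact_mod_cast Nat.lt_succ_self N)
  rw [card_univ, Fintype.card_fin, Nat.add_sub_cancel] at key
  have hc : P.coeff N = 1 := by rw [← hdeg]; exact hP
  rw [hc, Fin.sum_univ_succ] at key
  have h0 : P.eval (v 0) / ∏ j ∈ univ.erase 0, (v 0 - v j) = t ^ N := by
    rw [prod_erase_eq_prod_ite, Fin.prod_univ_succ]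
    simp only [v, P, eval_prod, eval_sub, eval_X, eval_C, Fin.cons_zero, Fin.cons_succ, if_true,
      Fin.succ_ne_zero, if_false, one_mul, zero_sub]
    rw [← prod_div_distrib]
    have : ∀ j, -(t * x j) / -x j = t := fun j => by
      rw [neg_div_neg_eq, mul_div_cancel_right₀ _ (hx0 j)]
    simp [this]
  have h1 : ∀ i : Fin N, P.eval (v i.succ) / ∏ j ∈ univ.erase i.succ, (v i.succ - v j) =
      (1 - t) * ∏ j ∈ univ.erase i, (x i - t * x j) / (x i - x j) := by
    intro i
    rw [prod_erase_eq_prod_ite, Fin.prod_univ_succ]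
    simp only [v, P, eval_prod, eval_sub, eval_X, eval_C, Fin.cons_zero, Fin.cons_succ,
      (Fin.succ_ne_zero i).symm, if_false, Fin.succ_inj, sub_zero]
    rw [← prod_erase_eq_prod_ite, ← mul_prod_erase univ _ (mem_univ i), prod_div_distrib,
      show x i - t * x i = x i * (1 - t) by ring, mul_assoc, mul_div_mul_left _ _ (hx0 i),
      mul_div_assoc]
  rw [h0, sum_congr rfl fun i _ => h1 i, ← mul_sum] at key
  have ht' : 1 - t ≠ 0 := sub_ne_zero.2 (Ne.symm ht)
  refine mul_left_cancel₀ ht' ?_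
  rw [mul_neg_geom_sum]
  linear_combination -key

theorem prod_filter_lt_succ {B : Type*} [CommMonoid B] (f : Fin (N + 1) × Fin (N + 1) → B) :
    ∏ p : Fin (N + 1) × Fin (N + 1) with p.1 < p.2, f p =
      (∏ j : Fin N, f (0, j.succ)) *
        ∏ p : Fin N × Fin N with p.1 < p.2, f (p.1.succ, p.2.succ) := by
  rw [prod_filter, prod_filter, Fintype.prod_prod_type, Fintype.prod_prod_type, Fin.prod_univ_succ,
    Fin.prod_univ_succ]
  simp only [lt_irrefl, if_false, one_mul, Fin.succ_pos, if_true]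
  congr 1
  refine prod_congr rfl fun i _ => ?_
  rw [Fin.prod_univ_succ]
  simp

theorem prod_swap_succ {B : Type*} [CommMonoid B] (p : Fin (N + 1)) (f : Fin (N + 1) → B) :
    ∏ j : Fin N, f (Equiv.swap 0 p j.succ) = ∏ k ∈ univ.erase p, f k := by
  have h1 : ∏ j : Fin N, f (Equiv.swap 0 p j.succ) =
      ∏ k : Fin (N + 1), if k = 0 then 1 else f (Equiv.swap 0 p k) := by
    rw [Fin.prod_univ_succ]; simp
  rw [h1, prod_erase_eq_prod_ite]
  refine Fintype.prod_equiv (Equiv.swap 0 p) _ _ fun k => ?_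
  have : Equiv.swap 0 p k = p ↔ k = 0 := by
    rw [← Equiv.eq_symm_apply, Equiv.symm_swap, Equiv.swap_apply_right]
  simp only [this]

/-- The sum of `w (∏_{i < j} (x_i - t x_j) / (x_i - x_j))` over all permutations `w`, computed by
splitting off the value of `w` at the first index. -/
theorem sum_hlKernel (t : F) {x : Fin N → F} (hx : Function.Injective x) (hx0 : ∀ i, x i ≠ 0) :
    ∑ w, hlKernel t x w = evalAt t (vFactor N) := by
  induction N with
  | zero =>
    simp [hlKernel]
  | succ N ih =>
    rw [vFactor_succ, map_mul, map_sum, ← Equiv.sum_comp Equiv.Perm.decomposeFin.symm,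
      Fintype.sum_prod_type]
    have h1 : ∀ (p : Fin (N + 1)) (e : Equiv.Perm (Fin N)),
        hlKernel t x (Equiv.Perm.decomposeFin.symm (p, e)) =
          (∏ k ∈ univ.erase p, (x p - t * x k) / (x p - x k)) *
            hlKernel t (fun i : Fin N => x (Equiv.swap 0 p i.succ)) e := by
      intro p e
      rw [hlKernel, prod_filter_lt_succ]
      simp only [Equiv.Perm.decomposeFin_symm_apply_zero, Equiv.Perm.decomposeFin_symm_apply_succ]
      rw [← prod_swap_succ]
      congr 1
      exact Equiv.prod_comp e fun j =>
        (x p - t * x (Equiv.swap 0 p j.succ)) / (x p - x (Equiv.swap 0 p j.succ))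
    simp only [h1, ← mul_sum]
    have h2 : ∀ p : Fin (N + 1),
        ∑ e, hlKernel t (fun i : Fin N => x (Equiv.swap 0 p i.succ)) e =
          evalAt t (vFactor N) := fun p =>
      ih (fun i j h => Fin.succ_injective _ ((Equiv.swap 0 p).injective (hx h))) fun i => hx0 _
    simp only [h2, ← sum_mul, sum_prod_ratio t hx hx0, map_pow, evalAt_X]
    rw [mul_comm]

theorem rowLen_bot (i : ℕ) : (⊥ : YoungDiagram).rowLen i = 0 := by
  by_contra h
  exact YoungDiagram.notMem_bot (i, 0)
    (YoungDiagram.mem_iff_lt_rowLen.2 (Nat.pos_of_ne_zero h))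

theorem colLen_bot (i : ℕ) : (⊥ : YoungDiagram).colLen i = 0 := by
  rw [colLen_eq_zero_iff, rowLen_bot]
  exact Nat.zero_le i

theorem hlP_bot {t : F} (ht : ∀ m, evalAt t (vFactor m) ≠ 0) {x : Fin N → F}
    (hx : Function.Injective x) (hx0 : ∀ i, x i ≠ 0) : hlP t x ⊥ = 1 := by
  have h1 : vPoly N ⊥ = vFactor N := by
    simp [vPoly, rowLen_bot]
  rw [hlP, if_pos (by rw [colLen_bot]; exact Nat.zero_le N), h1, hlSum]
  simp only [rowLen_bot, pow_zero, prod_const_one, one_mul]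
  rw [sum_hlKernel t hx hx0, inv_mul_cancel₀ (ht N)]

end Field

/-! ### The transition matrix from Schur to Hall–Littlewood functions -/

/-- The sum of the first `j` column lengths of `μ`. The dominance order on partitions is the reverse
of the order of these sums. -/
def colSum (μ : YoungDiagram) (j : ℕ) : ℕ := ∑ i ∈ range j, μ.colLen i

theorem colSum_succ (μ : YoungDiagram) (j : ℕ) : colSum μ (j + 1) = colSum μ j + μ.colLen j :=
  sum_range_succ _ _

theorem colSum_injective {μ ν : YoungDiagram} (h : ∀ j, colSum μ j = colSum ν j) : μ = ν :=
  ext_colLen fun j => by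
    have h1 := h (j + 1)
    rw [colSum_succ, colSum_succ, h j] at h1
    omega

theorem colSum_eq_card (μ : YoungDiagram) {M : ℕ} (h : μ.rowLen 0 ≤ M) : colSum μ M = μ.card :=
  (card_eq_sum_colLen μ h).symm

/-- Adding a vertical strip of size `m` is dominated by adding a first column of length `m`. -/
theorem add_colSum_le {lam μ : YoungDiagram} {m : ℕ} (h : vStrip lam μ ≠ 0)
    (hc : lam.card = μ.card + m) (j : ℕ) : m + colSum μ j ≤ colSum lam (j + 1) := by
  obtain ⟨hle, hi⟩ := vStrip_ne_zero h
  have key : ∀ n, colSum lam (j + 1 + n) + colSum μ j ≤ colSum lam (j + 1) + colSum μ (j + n) := by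
    intro n
    induction n with
    | zero => simp
    | succ n ih =>
      rw [← add_assoc, ← add_assoc, colSum_succ, colSum_succ μ (j + n)]
      have := hi (j + n)
      rw [show j + n + 1 = j + 1 + n by omega] at this
      omega
  have h1 := key (lam.rowLen 0)
  have hμ : μ.rowLen 0 ≤ lam.rowLen 0 := by
    rw [← colLen_eq_zero_iff]
    have h2 := colLen_le_of_le hle (lam.rowLen 0)
    have h3 : lam.colLen (lam.rowLen 0) = 0 := colLen_eq_zero_iff.2 le_rfl
    omega
  rw [colSum_eq_card lam (Nat.le_add_left _ _),
    colSum_eq_card μ (M := j + lam.rowLen 0) (by omega)] at h1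
  omega

/-- `c` is the row belonging to `η` of the transition matrix from Schur to Hall–Littlewood
functions, for every field, parameter and number of variables at once; Schur functions are
Hall–Littlewood functions for `t = 0`. The matrix is unitriangular for the dominance order. -/
structure IsUniversalExpansion (η : YoungDiagram) (c : YoungDiagram → ℤ[X]) : Prop where
  card_eq : ∀ κ, c κ ≠ 0 → κ.card = η.card
  diag : c η = 1
  colSum_le : ∀ κ, c κ ≠ 0 → ∀ j, colSum η j ≤ colSum κ j
  expansion : ∀ {F : Type} [Field F] {N : ℕ} {t : F} (_ : ∀ m, evalAt t (vFactor m) ≠ 0)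
    {x : Fin N → F} (_ : Function.Injective x) (_ : ∀ i, x i ≠ 0),
    hlP 0 x η = ∑ κ ∈ partitionsOf η.card, evalAt t (c κ) * hlP t x κ

theorem evalAt_zero {A : Type*} [CommRing A] (p : ℤ[X]) :
    evalAt (0 : A) p = (p.eval 0 : ℤ) := by
  simpa using evalAt_intCast (A := A) 0 p

theorem evalAt_zero_vFactor {F : Type*} [Field F] (m : ℕ) : evalAt (0 : F) (vFactor m) ≠ 0 := by
  rw [evalAt_zero, eval_zero_vFactor]; simp

theorem evalAt_intC {A : Type*} [CommRing A] (t : A) (a : ℤ) : evalAt t (C a) = (a : A) := by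
  simp [evalAt]

/-- By induction on `|η|` and downwards on the length `m` of the first column of `η`: if `ν` is `η`
without its first column, then `e_m s_ν` is `s_η` plus Schur functions of diagrams with a longer
first column, while the Pieri formula expands `e_m s_ν` in Hall–Littlewood functions once `s_ν` is
so expanded. -/
theorem exists_isUniversalExpansion (η : YoungDiagram) : ∃ c, IsUniversalExpansion η c := by
  classical
  induction hd : η.card using Nat.strong_induction_on generalizing η with
  | _ d ihd =>
  rcases Nat.eq_zero_or_pos d with rfl | hdpos
  · obtain rfl := card_eq_zero_iff.1 hd
    refine ⟨fun κ => if κ = ⊥ then 1 else 0, fun κ h => ?_, if_pos rfl, fun κ h => ?_, ?_⟩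
    · by_cases hκ : κ = ⊥
      · rw [hκ]
      · exact absurd (if_neg hκ) h
    · by_cases hκ : κ = ⊥
      · rw [hκ]; exact fun _ => le_rfl
      · exact absurd (if_neg hκ) h
    · intro F _ N t ht x hx hx0
      rw [hlP_bot evalAt_zero_vFactor hx hx0, sum_eq_single ⊥]
      · simp [hlP_bot ht hx hx0]
      · intro κ _ hκ
        simp [hκ]
      · simp [mem_partitionsOf]
  induction hk : d - η.colLen 0 using Nat.strong_induction_on generalizing η with
  | _ k ihk =>
  subst hk
  set m := η.colLen 0 with hm
  -- `ν` is `η` without its first column.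
  obtain ⟨ν, hν⟩ := exists_colLen_eq (fun j => η.colLen (j + 1))
    (fun a b h => η.colLen_anti _ _ (Nat.succ_le_succ h)) (η.rowLen 0)
    (colLen_eq_zero_iff.2 (Nat.le_succ _))
  have hsum : ∀ j, colSum η (j + 1) = m + colSum ν j := by
    intro j
    rw [colSum, sum_range_succ', add_comm]
    congr 1
    exact sum_congr rfl fun i _ => (hν i).symm
  have hνrow : ν.rowLen 0 ≤ η.rowLen 0 := by
    rw [← colLen_eq_zero_iff, hν]; exact colLen_eq_zero_iff.2 (Nat.le_succ _)
  have hcard : d = ν.card + m := by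
    rw [← hd, ← colSum_eq_card η (Nat.le_succ _), hsum, colSum_eq_card ν hνrow, add_comm]
  have hmpos : 0 < m := by
    rw [Nat.pos_iff_ne_zero, hm, Ne, colLen_eq_zero_iff, Nat.le_zero]
    intro h
    have := card_eq_sum_colLen η h.le
    rw [range_zero, sum_empty] at this
    omega
  have hνη : ν ≤ η := le_iff_colLen.2 fun j => by
    rw [hν]; exact η.colLen_anti _ _ (Nat.le_succ j)
  have hvη : vStrip η ν = 1 := by
    rw [vStrip_eq hνη le_rfl]
    exact prod_eq_one fun i _ => by rw [hν, gauss_self]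
  obtain ⟨cν, hcν⟩ := ihd ν.card (by omega) ν rfl
  -- The other diagrams that occur in `e_m s_ν` have a longer first column.
  have hlong : ∀ lam : YoungDiagram, lam.card = d → lam ≠ η → vStrip lam ν ≠ 0 →
      m < lam.colLen 0 := by
    intro lam hlam hne hv
    have h1 := add_colSum_le hv (hlam.trans hcard) 0
    simp only [colSum, zero_add, sum_range_one, range_zero, sum_empty, add_zero] at h1
    refine lt_of_le_of_ne h1 fun h2 => hne (eq_of_le_of_card_eq (le_iff_colLen.2 fun j => ?_)
      (hlam.trans hd.symm))
    cases j with
    | zero => exact h2.ge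
    | succ j => rw [← hν]; exact (vStrip_ne_zero hv).2 j
  have hrest : ∀ lam : YoungDiagram, ∃ c, lam.card = d → lam ≠ η → vStrip lam ν ≠ 0 →
      IsUniversalExpansion lam c := by
    intro lam
    by_cases h : lam.card = d ∧ lam ≠ η ∧ vStrip lam ν ≠ 0
    · obtain ⟨h1, h2, h3⟩ := h
      have h4 := hlong lam h1 h2 h3
      have h5 := colLen_le_card lam 0
      obtain ⟨c, hc⟩ := ihk (d - lam.colLen 0) (by omega) lam h1 rfl
      exact ⟨c, fun _ _ _ => hc⟩
    · exact ⟨0, fun h1 h2 h3 => absurd ⟨h1, h2, h3⟩ h⟩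
  choose cr hcr using hrest
  set S : Finset YoungDiagram := (partitionsOf d).erase η with hS
  let c : YoungDiagram → ℤ[X] := fun κ => if κ.card = d then
    ∑ τ ∈ partitionsOf ν.card, cν τ * vStrip κ τ -
      ∑ lam ∈ S, C ((vStrip lam ν).eval 0) * cr lam κ else 0
  have hcase : ∀ κ, c κ ≠ 0 → κ.card = d ∧
      ((∃ τ ∈ partitionsOf ν.card, cν τ ≠ 0 ∧ vStrip κ τ ≠ 0) ∨
        ∃ lam ∈ S, vStrip lam ν ≠ 0 ∧ cr lam κ ≠ 0) := by
    intro κ h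
    by_cases hκ : κ.card = d
    swap
    · exact absurd (if_neg hκ) h
    refine ⟨hκ, ?_⟩
    by_contra! hcon
    refine h ?_
    simp only [c, if_pos hκ]
    rw [sum_eq_zero, sum_eq_zero, sub_zero]
    · intro lam hlam
      by_cases h0 : vStrip lam ν = 0
      · simp [h0]
      · rw [hcon.2 lam hlam h0, mul_zero]
    · intro τ hτ
      by_cases h0 : cν τ = 0
      · simp [h0]
      · rw [hcon.1 τ hτ h0, mul_zero]
  have hdom : ∀ lam : YoungDiagram, lam.card = d → vStrip lam ν ≠ 0 →
      ∀ j, colSum η j ≤ colSum lam j := by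
    intro lam hlam hv j
    cases j with
    | zero => simp [colSum]
    | succ j => rw [hsum]; exact add_colSum_le hv (hlam.trans hcard) j
  have hSmem : ∀ lam ∈ S, lam.card = d ∧ lam ≠ η := fun lam h =>
    ⟨mem_partitionsOf.1 (mem_of_mem_erase h), ne_of_mem_erase h⟩
  refine ⟨c, fun κ h => (hcase κ h).1.trans hd.symm, ?_, fun κ h => ?_, ?_⟩
  · simp only [c, if_pos hd]
    rw [sum_eq_single_of_mem ν (mem_partitionsOf.2 rfl), sum_eq_zero, hcν.diag, hvη]
    · ring
    · intro lam hlam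
      obtain ⟨h1, h2⟩ := hSmem lam hlam
      by_cases h0 : vStrip lam ν = 0
      · simp [h0]
      · have h3 : cr lam η = 0 := by
          by_contra h4
          have h5 := (hcr lam h1 h2 h0).colSum_le η h4 1
          have h6 := hlong lam h1 h2 h0
          simp only [colSum, sum_range_one] at h5
          omega
        rw [h3, mul_zero]
    · intro τ hτ hne
      by_contra h0
      have h1 : cν τ ≠ 0 := fun h => h0 (by rw [h, zero_mul])
      have h2 : vStrip η τ ≠ 0 := fun h => h0 (by rw [h, mul_zero])
      refine hne (colSum_injective fun j => ?_)
      have h3 := add_colSum_le h2 (by rw [hd, mem_partitionsOf.1 hτ, hcard]) j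
      have h4 := hcν.colSum_le τ h1 j
      rw [hsum] at h3
      omega
  · obtain ⟨hκ, ⟨τ, hτ, h1, h2⟩ | ⟨lam, hlam, h1, h2⟩⟩ := hcase κ h
    · intro j
      cases j with
      | zero => simp [colSum]
      | succ j =>
        rw [hsum]
        have h3 := add_colSum_le h2 (by rw [hκ, mem_partitionsOf.1 hτ, hcard]) j
        have h4 := hcν.colSum_le τ h1 j
        omega
    · obtain ⟨h3, h4⟩ := hSmem lam hlam
      exact fun j => (hdom lam h3 h1 j).trans ((hcr lam h3 h4 h1).colSum_le κ h2 j)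
  · intro F _ N t ht x hx hx0
    have e1 := signedElem_mul_hlP (t := (0 : F)) evalAt_zero_vFactor hx ν m
    rw [← hcard, ← add_sum_erase _ _ (mem_partitionsOf.2 hd), hvη, map_one, mul_one, ← hS,
      hcν.expansion ht hx hx0, mul_sum] at e1
    have e2 : ∀ τ ∈ partitionsOf ν.card,
        signedElem m x * (evalAt t (cν τ) * hlP t x τ) =
          ∑ κ ∈ partitionsOf d, (-1) ^ m * (evalAt t (cν τ * vStrip κ τ) * hlP t x κ) := by
      intro τ hτ
      have h1 := signedElem_mul_hlP ht hx τ m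
      rw [mem_partitionsOf.1 hτ, ← hcard] at h1
      rw [mul_left_comm, h1, mul_sum]
      refine sum_congr rfl fun κ _ => ?_
      rw [map_mul]; ring
    have e3 : ∀ lam ∈ S, (-1) ^ m * evalAt 0 (vStrip lam ν) * hlP 0 x lam =
        ∑ κ ∈ partitionsOf d,
          (-1) ^ m * (evalAt t (C ((vStrip lam ν).eval 0) * cr lam κ) * hlP t x κ) := by
      intro lam hlam
      obtain ⟨h1, h2⟩ := hSmem lam hlam
      by_cases h0 : vStrip lam ν = 0
      · simp [h0]
      · rw [(hcr lam h1 h2 h0).expansion ht hx hx0, h1, mul_sum]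
        refine sum_congr rfl fun κ _ => ?_
        rw [map_mul, evalAt_intC, evalAt_zero]; ring
    rw [sum_congr rfl e2, sum_congr rfl e3, sum_comm, sum_comm (s := S), ← sub_eq_iff_eq_add,
      ← sum_sub_distrib] at e1
    have e4 : ((-1 : F) ^ m) * (-1) ^ m = 1 := by rw [← mul_pow]; simp
    rw [hd, ← one_mul (hlP 0 x η), ← e4, mul_assoc, ← e1, mul_sum]
    refine sum_congr rfl fun κ hκ => ?_
    simp only [c, if_pos (mem_partitionsOf.1 hκ), map_sub, map_sum, ← mul_sum, ← sum_mul]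
    linear_combination (∑ τ ∈ partitionsOf ν.card, evalAt t (cν τ * vStrip κ τ) -
      ∑ lam ∈ S, evalAt t (C ((vStrip lam ν).eval 0) * cr lam κ)) * hlP t x κ * e4

/-! ### Linear independence of Hall–Littlewood functions -/

/-- A statistic that is strictly monotone for the dominance order on partitions of `d`. -/
def dominanceWeight (d : ℕ) (μ : YoungDiagram) : ℕ := ∑ j ∈ range (d + 1), colSum μ j

theorem dominanceWeight_lt {d : ℕ} {η κ : YoungDiagram} (hη : η.card = d) (hκ : κ.card = d)
    (h : ∀ j, colSum η j ≤ colSum κ j) (hne : η ≠ κ) :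
    dominanceWeight d η < dominanceWeight d κ := by
  refine sum_lt_sum (fun j _ => h j) ?_
  by_contra! hcon
  refine hne (colSum_injective fun j => ?_)
  by_cases hj : j < d + 1
  · exact le_antisymm (h j) (hcon j (mem_range.2 hj))
  · have h1 := rowLen_le_card η 0
    have h2 := rowLen_le_card κ 0
    rw [colSum_eq_card η (by omega), colSum_eq_card κ (by omega), hη, hκ]

/-- The matrix entries `K_{ηκ}(q)` of a universal expansion of Schur functions in Hall–Littlewood
functions. -/
noncomputable def schurToHL (η : YoungDiagram) : YoungDiagram → ℤ[X] :=
  (exists_isUniversalExpansion η).choose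

theorem isUniversalExpansion_schurToHL (η : YoungDiagram) :
    IsUniversalExpansion η (schurToHL η) :=
  (exists_isUniversalExpansion η).choose_spec

theorem dominanceWeight_lt_of_schurToHL_ne_zero {d : ℕ} {η κ : YoungDiagram} (hη : η.card = d)
    (h : schurToHL η κ ≠ 0) (hne : η ≠ κ) : dominanceWeight d η < dominanceWeight d κ :=
  dominanceWeight_lt hη (((isUniversalExpansion_schurToHL η).card_eq κ h).trans hη)
    ((isUniversalExpansion_schurToHL η).colSum_le κ h) hne

/-- The square matrix of the `K_{ηκ}(q)` for partitions of `d`. -/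
noncomputable def transMatrix (d : ℕ) : Matrix (partitionsOf d) (partitionsOf d) ℤ[X] :=
  Matrix.of fun η κ => schurToHL η κ

theorem det_transMatrix [DecidableEq YoungDiagram] (d : ℕ) : (transMatrix d).det = 1 := by
  have htri : (transMatrix d).BlockTriangular fun η => dominanceWeight d η := by
    intro η κ hlt
    by_contra h
    have hη := mem_partitionsOf.1 η.2
    rcases eq_or_ne (η : YoungDiagram) κ with heq | hne
    · obtain rfl := Subtype.ext heq
      exact lt_irrefl _ hlt
    · exact lt_asymm hlt (dominanceWeight_lt_of_schurToHL_ne_zero hη h hne)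
  rw [htri.det]
  refine prod_eq_one fun a _ => ?_
  have h1 : (transMatrix d).toSquareBlock (fun η => dominanceWeight d η) a = 1 := by
    ext1 η κ
    rw [Matrix.toSquareBlock_def, Matrix.of_apply, transMatrix, Matrix.of_apply]
    rcases eq_or_ne η κ with rfl | hne
    · rw [Matrix.one_apply_eq]
      exact (isUniversalExpansion_schurToHL _).diag
    · rw [Matrix.one_apply_ne hne]
      by_contra h
      have h3 := dominanceWeight_lt_of_schurToHL_ne_zero (mem_partitionsOf.1 η.1.2) h
        fun h2 => hne (Subtype.ext (Subtype.ext h2))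
      rw [η.2, κ.2] at h3
      exact lt_irrefl _ h3
  rw [h1, Matrix.det_one]

section Monomial

variable {N : ℕ}

theorem evalAt_coeffHom_X (p : ℤ[X]) : evalAt (coeffHom N X) p = coeffHom N p := by
  rw [← map_evalAt]
  congr 1
  have : evalAt (X : ℤ[X]) = RingHom.id ℤ[X] :=
    Polynomial.ringHom_ext' (RingHom.ext_int _ _) (by simp)
  rw [this]; rfl

theorem coeffHom_injective : Function.Injective (coeffHom N) :=
  (IsFractionRing.injective (MvPolynomial (Fin N) ℤ[X]) (RatField N)).comp
    (MvPolynomial.C_injective _ _)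

theorem xvar_injective : Function.Injective (xvar N) :=
  (IsFractionRing.injective (MvPolynomial (Fin N) ℤ[X]) (RatField N)).comp
    MvPolynomial.X_injective

theorem xvar_ne_zero (i : Fin N) : xvar N i ≠ 0 :=
  (map_ne_zero_iff _ (IsFractionRing.injective _ _)).2 (MvPolynomial.X_ne_zero i)

theorem evalAt_coeffHom_vFactor_ne_zero (m : ℕ) : evalAt (coeffHom N X) (vFactor m) ≠ 0 := by
  rw [evalAt_coeffHom_X]
  exact (map_ne_zero_iff _ coeffHom_injective).2 (vFactor_ne_zero m)

theorem evalAt_one {A : Type*} [CommRing A] (p : ℤ[X]) :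
    evalAt (1 : A) p = (p.eval 1 : ℤ) := by
  simpa using evalAt_intCast (A := A) 1 p

theorem evalAt_one_vFactor_ne_zero (m : ℕ) : evalAt (1 : RatField N) (vFactor m) ≠ 0 := by
  rw [evalAt_one, eval_one_vFactor]
  exact_mod_cast m.factorial_ne_zero

/-- The first `N` parts of `μ` as an exponent vector. -/
noncomputable def rowVec (N : ℕ) (μ : YoungDiagram) : Fin N →₀ ℕ :=
  Finsupp.equivFunOnFinite.symm fun i => μ.rowLen i

theorem prod_xvar_pow (a : Fin N →₀ ℕ) : ∏ i, xvar N i ^ a i =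
    algebraMap (MvPolynomial (Fin N) ℤ[X]) (RatField N) (MvPolynomial.monomial a 1) := by
  rw [MvPolynomial.monomial_eq, map_one, one_mul, Finsupp.prod_fintype _ _ fun i => pow_zero _,
    map_prod]
  simp [xvar]

/-- The sum of the monomials `w (x^μ)` over all permutations `w`. -/
noncomputable def permSum (N : ℕ) (μ : YoungDiagram) : MvPolynomial (Fin N) ℤ[X] :=
  ∑ w : Equiv.Perm (Fin N),
    MvPolynomial.monomial (Finsupp.equivFunOnFinite.symm fun i => μ.rowLen (w i)) 1

/-- The number of permutations of the first `N` parts of `μ` that fix `μ`. -/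
def stabCard (N : ℕ) (μ : YoungDiagram) : ℕ :=
  #{w : Equiv.Perm (Fin N) | ∀ i, μ.rowLen (w i) = μ.rowLen i}

theorem stabCard_ne_zero (μ : YoungDiagram) : stabCard N μ ≠ 0 :=
  card_ne_zero_of_mem (a := 1) (by simp)

theorem eval_one_vPoly (μ : YoungDiagram) : (vPoly N μ).eval 1 = (stabCard N μ : ℤ) := by
  let f : Fin N → Fin (μ.rowLen 0 + 1) := fun i =>
    ⟨μ.rowLen i, Nat.lt_succ_of_le (μ.rowLen_anti 0 i (Nat.zero_le _))⟩
  have h1 := DomMulAct.stabilizer_card f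
  have h2 : stabCard N μ = Fintype.card {g : Equiv.Perm (Fin N) // f ∘ g = f} := by
    rw [Fintype.card_subtype, stabCard]
    congr 1
    ext w
    simp only [mem_filter, mem_univ, true_and, funext_iff, Function.comp, f, Fin.mk.injEq]
  rw [h2, h1, vPoly, eval_prod, prod_range, Nat.cast_prod]
  refine prod_congr rfl fun k _ => ?_
  rw [eval_one_vFactor, Fintype.card_subtype]
  simp only [f, Fin.ext_iff]

open Classical in
theorem coeff_permSum {μ κ : YoungDiagram} (hμ : μ.colLen 0 ≤ N) (hκ : κ.colLen 0 ≤ N) :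
    (permSum N κ).coeff (rowVec N μ) = if κ = μ then (stabCard N κ : ℤ[X]) else 0 := by
  rw [permSum, MvPolynomial.coeff_sum]
  simp only [MvPolynomial.coeff_monomial, rowVec, EmbeddingLike.apply_eq_iff_eq, funext_iff]
  rw [sum_boole]
  split_ifs with h
  · subst h; rfl
  · rw [card_eq_zero.2, Nat.cast_zero]
    refine filter_eq_empty_iff.2 fun w _ hw => h ?_
    -- The multiplicities of the parts agree, hence so do the column lengths.
    refine ext_colLen fun j => ?_
    have hcol : ∀ ν : YoungDiagram, ν.colLen 0 ≤ N →
        ν.colLen j = #{i : Fin N | j < ν.rowLen i} := by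
      intro ν hν
      simp only [lt_rowLen_iff_lt_colLen]
      rw [Fin.card_filter_val_lt, min_eq_right ((ν.colLen_anti 0 j (Nat.zero_le j)).trans hν)]
    rw [hcol κ hκ, hcol μ hμ]
    simp only [← hw]
    refine (card_equiv w fun i => ?_).symm
    simp

theorem hlKernel_one {F : Type*} [Field F] {x : Fin N → F} (hx : Function.Injective x)
    (w : Equiv.Perm (Fin N)) : hlKernel 1 x w = 1 :=
  prod_eq_one fun p hp => by
    rw [one_mul]
    refine div_self (sub_ne_zero.2 fun h => ?_)
    have := (mem_filter.1 hp).2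
    rw [w.injective (hx h)] at this
    exact lt_irrefl _ this

/-- At `t = 1`, the Hall–Littlewood polynomials are the monomial symmetric polynomials. -/
theorem stabCard_mul_hlP_one {μ : YoungDiagram} (h : μ.colLen 0 ≤ N) :
    (stabCard N μ : RatField N) * hlP 1 (xvar N) μ =
      algebraMap (MvPolynomial (Fin N) ℤ[X]) (RatField N) (permSum N μ) := by
  have hne : (stabCard N μ : RatField N) ≠ 0 := by exact_mod_cast stabCard_ne_zero μ
  rw [hlP, if_pos h, evalAt_one, eval_one_vPoly, Int.cast_natCast, mul_inv_cancel_left₀ hne, hlSum,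
    permSum, map_sum, ← Equiv.sum_comp (Equiv.inv (Equiv.Perm (Fin N)))]
  refine sum_congr rfl fun w _ => ?_
  rw [hlKernel_one xvar_injective, mul_one, ← prod_xvar_pow]
  refine Fintype.prod_equiv w⁻¹ _ _ fun i => ?_
  simp

/-- The coefficients of an expansion in monomial symmetric functions are read off from the
monomials. -/
theorem eq_coeff_of_sum_hlP_one {d : ℕ} (hd : d ≤ N) (a : YoungDiagram → ℤ[X])
    (p : MvPolynomial (Fin N) ℤ[X])
    (h : ∑ κ ∈ partitionsOf d, coeffHom N (a κ) * hlP 1 (xvar N) κ =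
      algebraMap (MvPolynomial (Fin N) ℤ[X]) (RatField N) p)
    {μ : YoungDiagram} (hμ : μ.card = d) : a μ = p.coeff (rowVec N μ) := by
  classical
  have hlen : ∀ κ ∈ partitionsOf d, κ.colLen 0 ≤ N := fun κ hκ =>
    (colLen_le_card κ 0).trans ((mem_partitionsOf.1 hκ).le.trans hd)
  -- Multiplication by `L` clears the denominators that come from the stabilizers.
  set L : ℕ := ∏ κ ∈ partitionsOf d, stabCard N κ with hL
  have hL0 : L ≠ 0 := prod_ne_zero_iff.2 fun κ _ => stabCard_ne_zero κ
  have h1 : ∑ κ ∈ partitionsOf d, MvPolynomial.C (a κ *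
      (∏ τ ∈ (partitionsOf d).erase κ, stabCard N τ : ℕ)) * permSum N κ =
        MvPolynomial.C (L : ℤ[X]) * p := by
    apply IsFractionRing.injective (MvPolynomial (Fin N) ℤ[X]) (RatField N)
    rw [map_mul, ← h, mul_sum, map_sum]
    refine sum_congr rfl fun κ hκ => ?_
    rw [map_mul, ← stabCard_mul_hlP_one (hlen κ hκ), hL, ← mul_prod_erase _ _ hκ, coeffHom]
    simp only [map_mul, map_natCast, RingHom.comp_apply, Nat.cast_mul]
    ring
  have h2 := congrArg (MvPolynomial.coeff (rowVec N μ)) h1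
  have hμ' := mem_partitionsOf.2 hμ
  rw [MvPolynomial.coeff_C_mul, MvPolynomial.coeff_sum, sum_eq_single_of_mem μ hμ',
    MvPolynomial.coeff_C_mul, coeff_permSum (hlen μ hμ') (hlen μ hμ'), if_pos rfl, mul_assoc,
    ← Nat.cast_mul, prod_erase_mul _ _ hμ', ← hL, mul_comm] at h2
  · exact mul_left_cancel₀ (by exact_mod_cast hL0) h2
  · intro κ hκ hne
    rw [MvPolynomial.coeff_C_mul, coeff_permSum (hlen μ hμ') (hlen κ hκ), if_neg hne, mul_zero]

theorem coeffHom_intC (a : ℤ) : coeffHom N (C a) = (a : RatField N) := by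
  rw [show (C a : ℤ[X]) = (a : ℤ[X]) from eq_intCast C a, map_intCast]

/-- The Hall–Littlewood polynomials of degree `d` in at least `d` variables are linearly
independent over `ℤ[q]`. Unitriangular transition matrices reduce this first to Schur polynomials
and then to monomial symmetric polynomials. -/
theorem eq_zero_of_sum_hlP {d : ℕ} (hd : d ≤ N) (a : YoungDiagram → ℤ[X])
    (h : ∑ κ ∈ partitionsOf d, coeffHom N (a κ) * hlP (coeffHom N X) (xvar N) κ = 0)
    {μ : YoungDiagram} (hμ : μ.card = d) : a μ = 0 := by
  classical
  -- The coefficients `b` of the Schur polynomials are obtained by inverting the matrix `K` of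
  -- determinant one. The Schur polynomials do not involve `q`, so the relation between them may be
  -- expanded again, with the parameter `t = 1`.
  let K := transMatrix d
  have hdet : K.det = 1 := det_transMatrix d
  let a' : partitionsOf d → ℤ[X] := fun κ => a κ
  let b : partitionsOf d → ℤ[X] := Matrix.vecMul a' K⁻¹
  have hba : Matrix.vecMul b K = a' := by
    rw [Matrix.vecMul_vecMul, Matrix.nonsing_inv_mul _ (by rw [hdet]; exact isUnit_one),
      Matrix.vecMul_one]
  have hexp : ∀ {t : RatField N} (_ : ∀ m, evalAt t (vFactor m) ≠ 0),
      ∑ η, coeffHom N (b η) * hlP 0 (xvar N) (η : YoungDiagram) =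
        ∑ κ : partitionsOf d, (∑ η, coeffHom N (b η) * evalAt t (K η κ)) *
          hlP t (xvar N) (κ : YoungDiagram) := by
    intro t ht
    simp only [sum_mul]
    rw [sum_comm]
    refine sum_congr rfl fun η _ => ?_
    rw [(isUniversalExpansion_schurToHL η).expansion ht xvar_injective xvar_ne_zero, mul_sum,
      mem_partitionsOf.1 η.2, ← sum_coe_sort]
    exact sum_congr rfl fun κ _ => (mul_assoc _ _ _).symm
  have h0 : ∑ η, coeffHom N (b η) * hlP 0 (xvar N) (η : YoungDiagram) = 0 := by
    rw [hexp evalAt_coeffHom_vFactor_ne_zero, ← h, ← sum_coe_sort (partitionsOf d)]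
    refine sum_congr rfl fun κ _ => ?_
    congr 1
    have h1 := congrFun hba κ
    simp only [a', Matrix.vecMul, dotProduct] at h1
    rw [← h1, map_sum]
    exact sum_congr rfl fun η _ => by rw [evalAt_coeffHom_X, map_mul]
  let φ : ℤ[X] →+* ℤ[X] := C.comp (evalRingHom 1)
  have hφ : Matrix.vecMul b (φ.mapMatrix K) = 0 := by
    funext κ
    rw [hexp evalAt_one_vFactor_ne_zero] at h0
    let e : YoungDiagram → ℤ[X] := fun κ =>
      ∑ η : partitionsOf d, b η * C ((schurToHL η κ).eval 1)
    have h1 : ∑ κ ∈ partitionsOf d, coeffHom N (e κ) * hlP 1 (xvar N) κ =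
        algebraMap (MvPolynomial (Fin N) ℤ[X]) (RatField N) 0 := by
      rw [map_zero, ← h0, ← sum_coe_sort]
      refine sum_congr rfl fun κ _ => ?_
      congr 1
      rw [map_sum]
      refine sum_congr rfl fun η _ => ?_
      rw [map_mul, coeffHom_intC, evalAt_one]
      rfl
    have h2 := eq_coeff_of_sum_hlP_one hd e 0 h1 (mem_partitionsOf.1 κ.2)
    rw [MvPolynomial.coeff_zero] at h2
    exact h2
  have hb : b = 0 := by
    refine Matrix.eq_zero_of_vecMul_eq_zero ?_ hφ
    rw [← RingHom.map_det, hdet, map_one]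
    exact one_ne_zero
  have := congrFun hba ⟨μ, mem_partitionsOf.2 hμ⟩
  rw [hb, Matrix.zero_vecMul] at this
  exact this.symm

end Monomial

/-! ### Products of complete symmetric functions -/

/-- The coefficient of `P_μ` in `h_{λ_1} ⋯ h_{λ_n}`, by iteration of the Pieri formula. -/
noncomputable def chainCoeff : {n : ℕ} → (Fin n → ℕ) → YoungDiagram → ℤ[X]
  | 0, _, μ => if μ.card = 0 then 1 else 0
  | _ + 1, lam, μ => ∑ ν ∈ partitionsOf (∑ k, Fin.init lam k),
      chainCoeff (Fin.init lam) ν * hStrip μ ν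

theorem chainCoeff_succ {n : ℕ} (lam : Fin (n + 1) → ℕ) (μ : YoungDiagram) :
    chainCoeff lam μ = ∑ ν ∈ partitionsOf (∑ k, Fin.init lam k),
      chainCoeff (Fin.init lam) ν * hStrip μ ν := rfl

theorem sum_init_add_last {n : ℕ} (lam : Fin (n + 1) → ℕ) :
    ∑ k, lam k = ∑ k, Fin.init lam k + lam (Fin.last n) := by
  rw [Fin.sum_univ_castSucc]; rfl

theorem prod_completeSym {F : Type*} [Field F] {N : ℕ} {t : F}
    (ht : ∀ m, evalAt t (vFactor m) ≠ 0) {x : Fin N → F} (hx : Function.Injective x)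
    (hx0 : ∀ i, x i ≠ 0) {n : ℕ} (lam : Fin n → ℕ) :
    ∏ k, completeSym (lam k) x =
      ∑ μ ∈ partitionsOf (∑ k, lam k), evalAt t (chainCoeff lam μ) * hlP t x μ := by
  induction n with
  | zero =>
    rw [sum_eq_single ⊥]
    · simp [chainCoeff, hlP_bot ht hx hx0, card_eq_zero_iff.2]
    · intro μ hμ hne
      exact absurd (card_eq_zero_iff.1 (mem_partitionsOf.1 hμ)) hne
    · intro h
      exact absurd (mem_partitionsOf.2 (card_eq_zero_iff.2 rfl)) h
  | succ n ih =>
    rw [Fin.prod_univ_castSucc, ← show ∏ k, completeSym (Fin.init lam k) x =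
      ∏ k : Fin n, completeSym (lam k.castSucc) x from rfl, ih, sum_mul]
    have h1 : ∀ ν ∈ partitionsOf (∑ k, Fin.init lam k),
        evalAt t (chainCoeff (Fin.init lam) ν) * hlP t x ν * completeSym (lam (Fin.last n)) x =
          ∑ μ ∈ partitionsOf (∑ k, lam k),
            evalAt t (chainCoeff (Fin.init lam) ν * hStrip μ ν) * hlP t x μ := by
      intro ν hν
      have h2 := completeSym_mul_hlP ht hx ν (lam (Fin.last n))
      rw [mem_partitionsOf.1 hν, ← sum_init_add_last] at h2
      rw [mul_assoc, mul_comm (hlP t x ν), h2, mul_sum]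
      exact sum_congr rfl fun μ _ => by rw [map_mul, mul_assoc]
    rw [sum_congr rfl h1, sum_comm]
    refine sum_congr rfl fun μ _ => ?_
    rw [chainCoeff_succ, map_sum, sum_mul]

theorem completeSym_zero {F : Type*} [Field F] {N : ℕ} (x : Fin N → F) :
    completeSym 0 x = 1 := by
  rw [completeSym, completeSeries, PowerSeries.coeff_zero_eq_constantCoeff_apply, map_prod]
  refine prod_eq_one fun i _ => ?_
  rw [← PowerSeries.coeff_zero_eq_constantCoeff_apply, PowerSeries.coeff_mk, pow_zero]

theorem completeSym_xvar (N r : ℕ) : completeSym r (xvar N) =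
    algebraMap (MvPolynomial (Fin N) ℤ[X]) (RatField N)
      (∑ a ∈ finsuppAntidiag univ r, MvPolynomial.monomial a 1) := by
  rw [completeSym, completeSeries, PowerSeries.coeff_prod, map_sum]
  refine sum_congr rfl fun a _ => ?_
  rw [← prod_xvar_pow]
  exact prod_congr rfl fun i _ => PowerSeries.coeff_mk _ _

/-- The number of matrices of nonnegative integers with row sums `α` and column sums `β`. -/
noncomputable def matrixCount {n N : ℕ} (α : Fin n → ℕ) (β : Fin N →₀ ℕ) : ℕ :=
  #{A ∈ Fintype.piFinset fun k : Fin n => finsuppAntidiag (univ : Finset (Fin N)) (α k) |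
    ∑ k, A k = β}

theorem matrixCount_comm {N : ℕ} (α β : Fin N →₀ ℕ) : matrixCount α β = matrixCount β α := by
  have hmem : ∀ (α β : Fin N →₀ ℕ) (A : Fin N → Fin N →₀ ℕ),
      A ∈ ({A ∈ Fintype.piFinset fun k : Fin N => finsuppAntidiag (univ : Finset (Fin N)) (α k) |
        ∑ k, A k = β} : Finset _) ↔ (∀ k, ∑ j, A k j = α k) ∧ ∀ j, ∑ k, A k j = β j := by
    intro α β A
    simp [Fintype.mem_piFinset, mem_finsuppAntidiag, Finsupp.ext_iff, Finsupp.finsetSum_apply]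
  let T : (Fin N → Fin N →₀ ℕ) → Fin N → Fin N →₀ ℕ := fun A j =>
    Finsupp.equivFunOnFinite.symm fun k => A k j
  have hT : ∀ A, T (T A) = A := fun A => by
    funext k; ext j; rfl
  refine card_nbij' T T ?_ ?_ (fun A _ => hT A) fun A _ => hT A
  · intro A hA
    have := (hmem α β A).1 hA
    exact (hmem β α (T A)).2 ⟨this.2, this.1⟩
  · intro A hA
    have := (hmem β α A).1 hA
    exact (hmem α β (T A)).2 ⟨this.2, this.1⟩

theorem prod_completeSym_xvar {n : ℕ} (N : ℕ) (α : Fin n → ℕ) :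
    ∏ k, completeSym (α k) (xvar N) = algebraMap (MvPolynomial (Fin N) ℤ[X]) (RatField N)
      (∑ A ∈ Fintype.piFinset fun k : Fin n => finsuppAntidiag (univ : Finset (Fin N)) (α k),
        MvPolynomial.monomial (∑ k, A k) 1) := by
  simp only [completeSym_xvar]
  rw [← map_prod, prod_univ_sum]
  simp only [MvPolynomial.monomial_sum_one]

/-- At `q = 1`, the coefficients of `h_λ` in the monomial symmetric functions count matrices. -/
theorem eval_one_chainCoeff {n N : ℕ} (α : Fin n → ℕ) {μ : YoungDiagram}
    (hμ : μ.card = ∑ k, α k) (hN : ∑ k, α k ≤ N) :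
    (chainCoeff α μ).eval 1 = (matrixCount α (rowVec N μ) : ℤ) := by
  have h1 := prod_completeSym (t := (1 : RatField N)) evalAt_one_vFactor_ne_zero xvar_injective
    xvar_ne_zero α
  rw [prod_completeSym_xvar] at h1
  have h2 := eq_coeff_of_sum_hlP_one hN (fun μ => C ((chainCoeff α μ).eval 1)) _
    (by rw [h1]; simp only [coeffHom_intC, evalAt_one]) hμ
  rw [MvPolynomial.coeff_sum] at h2
  simp only [MvPolynomial.coeff_monomial] at h2
  rw [sum_boole] at h2
  apply C_injective
  rw [h2, matrixCount]
  simp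

theorem card_eq_sum_rowLen (μ : YoungDiagram) {N : ℕ} (h : μ.colLen 0 ≤ N) :
    μ.card = ∑ i : Fin N, μ.rowLen i := by
  have := card_eq_sum_colLen μ.transpose (M := N) (by rwa [YoungDiagram.rowLen_transpose])
  rw [card_transpose] at this
  rw [this, sum_range]
  exact sum_congr rfl fun i _ => by rw [YoungDiagram.colLen_transpose]

theorem sum_rowVec {d : ℕ} {μ : YoungDiagram} (hμ : μ.card = d) : ∑ i, rowVec d μ i = d := by
  have := card_eq_sum_rowLen μ (N := d) (hμ ▸ colLen_le_card μ 0)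
  rw [hμ] at this
  exact this.symm

theorem eval_one_chainCoeff_comm {d : ℕ} {κ μ : YoungDiagram} (hκ : κ.card = d)
    (hμ : μ.card = d) :
    (chainCoeff (rowVec d κ) μ).eval 1 = (chainCoeff (rowVec d μ) κ).eval 1 := by
  rw [eval_one_chainCoeff (N := d) _ (hμ.trans (sum_rowVec hκ).symm) (sum_rowVec hκ).le,
    eval_one_chainCoeff (N := d) _ (hκ.trans (sum_rowVec hμ).symm) (sum_rowVec hμ).le,
    matrixCount_comm]

/-! ### Horizontal strips -/

theorem eval_zero_hStrip {ν μ : YoungDiagram} (h : μ ≤ ν)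
    (h1 : ∀ i, ν.colLen i ≤ μ.colLen i + 1) : (hStrip ν μ).eval 0 = 1 := by
  rw [hStrip_eq h le_rfl, eval_prod]
  refine prod_eq_one fun i _ => ?_
  have h2 := h1 i
  have h3 := colLen_le_of_le h i
  rw [eval_mul, eval_zero_gauss (by omega),
    Nat.choose_eq_zero_of_lt (show ν.colLen i - μ.colLen i < 2 by omega)]
  simp

theorem le_of_eval_zero_hStrip_ne_zero {ν μ : YoungDiagram} (h : (hStrip ν μ).eval 0 ≠ 0) :
    μ ≤ ν ∧ ∀ i, ν.colLen i ≤ μ.colLen i + 1 := by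
  have hle : μ ≤ ν := le_of_hStrip_ne_zero fun h0 => h (by rw [h0, eval_zero])
  refine ⟨hle, fun i => ?_⟩
  by_contra! hi
  refine h ?_
  rw [hStrip_eq hle (le_max_left _ (i + 1)), eval_prod]
  refine prod_eq_zero (mem_range.2 (lt_of_lt_of_le (Nat.lt_succ_self i) (le_max_right _ _))) ?_
  have h2 : (ν.colLen i - μ.colLen i).choose 2 ≠ 0 := (Nat.choose_pos (by omega)).ne'
  simp [h2]

/-- A horizontal strip of size `r` has at most `min r j` boxes in the first `j` columns. -/
theorem colSum_le_add_min {ν μ : YoungDiagram} (h : (hStrip ν μ).eval 0 ≠ 0) {r : ℕ}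
    (hr : ν.card = μ.card + r) (j : ℕ) : colSum ν j ≤ colSum μ j + min r j := by
  obtain ⟨hle, h1⟩ := le_of_eval_zero_hStrip_ne_zero h
  have h2 : colSum ν j ≤ colSum μ j + j := by
    induction j with
    | zero => simp [colSum]
    | succ j ih =>
      rw [colSum_succ, colSum_succ]
      have := h1 j
      omega
  have h3 : ∀ n, colSum ν j + colSum μ (j + n) ≤ colSum μ j + colSum ν (j + n) := by
    intro n
    induction n with
    | zero => rw [add_zero, add_comm]
    | succ n ih =>
      rw [← add_assoc, colSum_succ, colSum_succ]
      have := colLen_le_of_le hle (j + n)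
      omega
  have h4 := h3 (ν.rowLen 0 + μ.rowLen 0)
  rw [colSum_eq_card ν (M := j + (ν.rowLen 0 + μ.rowLen 0)) (by omega),
    colSum_eq_card μ (M := j + (ν.rowLen 0 + μ.rowLen 0)) (by omega)] at h4
  omega

theorem colSum_le_of_chainCoeff_ne_zero {n : ℕ} {lam : Fin n → ℕ} {ν : YoungDiagram}
    (h : (chainCoeff lam ν).eval 0 ≠ 0) (hν : ν.card = ∑ k, lam k) (j : ℕ) :
    colSum ν j ≤ ∑ k, min (lam k) j := by
  induction n generalizing ν with
  | zero =>
    obtain rfl := card_eq_zero_iff.1 hν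
    simp [colSum, colLen_bot]
  | succ n ih =>
    rw [chainCoeff_succ, eval_finsetSum] at h
    obtain ⟨τ, hτ, h1⟩ := exists_ne_zero_of_sum_ne_zero h
    rw [eval_mul] at h1
    rw [mem_partitionsOf] at hτ
    have h2 := ih (left_ne_zero_of_mul h1) hτ
    have h3 := colSum_le_add_min (right_ne_zero_of_mul h1)
      (hν.trans ((sum_init_add_last lam).trans (by rw [hτ]))) j
    rw [Fin.sum_univ_castSucc]
    simp only [Fin.init] at h2
    omega

theorem sum_min_eq_sum_card {n : ℕ} (lam : Fin n → ℕ) (j : ℕ) :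
    ∑ k, min (lam k) j = ∑ i ∈ range j, #{k | i < lam k} := by
  induction j with
  | zero => simp
  | succ j ih =>
    rw [sum_range_succ, ← ih, card_filter, ← sum_add_distrib]
    refine sum_congr rfl fun k _ => ?_
    split_ifs <;> omega

/-- The Schur function of the diagram whose parts are the `λ_k` occurs exactly once in `h_λ`. -/
theorem eval_zero_chainCoeff_self {n : ℕ} (lam : Fin n → ℕ) {η : YoungDiagram}
    (h : ∀ j, η.colLen j = #{k | j < lam k}) : (chainCoeff lam η).eval 0 = 1 := by
  have hcol : ∀ {n : ℕ} (lam : Fin n → ℕ) {η : YoungDiagram}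
      (_ : ∀ j, η.colLen j = #{k | j < lam k}) (j : ℕ), colSum η j = ∑ k, min (lam k) j := by
    intro n lam η h j
    rw [sum_min_eq_sum_card]
    exact sum_congr rfl fun i _ => h i
  have hle : ∀ {n : ℕ} (lam : Fin n → ℕ) k, lam k ≤ ∑ k, lam k := fun lam k =>
    single_le_sum (f := lam) (fun _ _ => Nat.zero_le _) (mem_univ k)
  have hcard : ∀ {n : ℕ} (lam : Fin n → ℕ) {η : YoungDiagram}
      (_ : ∀ j, η.colLen j = #{k | j < lam k}), η.card = ∑ k, lam k := by
    intro n lam η h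
    rw [← colSum_eq_card η (M := max (η.rowLen 0) (∑ k, lam k)) (le_max_left _ _), hcol lam h]
    exact sum_congr rfl fun k _ => min_eq_left ((hle lam k).trans (le_max_right _ _))
  induction n generalizing η with
  | zero => simp [chainCoeff, hcard lam h]
  | succ n ih =>
    obtain ⟨ν, hν⟩ := exists_colLen_eq (fun j => #{k | j < Fin.init lam k})
      (fun a b hab => card_le_card fun k hk => by
        simp only [mem_filter, mem_univ, true_and] at hk ⊢
        exact lt_of_le_of_lt hab hk) (∑ k, Fin.init lam k)
      (card_eq_zero.2 (filter_eq_empty_iff.2 fun k _ => not_lt.2 (hle _ k)))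
    have hην : ∀ j, η.colLen j = ν.colLen j + if j < lam (Fin.last n) then 1 else 0 := by
      intro j
      rw [h, hν, card_filter, card_filter, Fin.sum_univ_castSucc]
      rfl
    have hνcard := hcard _ hν
    rw [chainCoeff_succ, eval_finsetSum, sum_eq_single_of_mem ν (mem_partitionsOf.2 hνcard),
      eval_mul, ih _ hν, eval_zero_hStrip, one_mul]
    · exact le_iff_colLen.2 fun j => by rw [hην]; omega
    · intro j
      rw [hην]
      split_ifs <;> omega
    · intro τ hτ hne
      rw [mem_partitionsOf] at hτ
      by_contra h0
      rw [eval_mul] at h0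
      refine hne (colSum_injective fun j => ?_)
      have h1 := colSum_le_of_chainCoeff_ne_zero (left_ne_zero_of_mul h0) hτ j
      have h2 := colSum_le_add_min (right_ne_zero_of_mul h0) (r := lam (Fin.last n))
        ((hcard lam h).trans ((sum_init_add_last lam).trans (by rw [hτ]))) j
      rw [hcol lam h, Fin.sum_univ_castSucc] at h2
      rw [← hcol _ hν] at h1
      have h3 := hcol _ hν j
      simp only [Fin.init] at h3
      omega

/-! ### Kostka numbers -/

/-- Two unitriangular matrices `A`, `B` with `Aᵀ B` symmetric are equal, by induction on the
weight of the row. -/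
theorem eq_of_transpose_mul_symm {I : Type*} [Fintype I] [DecidableEq I] (w : I → ℕ)
    (A B : I → I → ℤ) (hA : ∀ j, A j j = 1) (hB : ∀ j, B j j = 1)
    (hA' : ∀ i j, A i j ≠ 0 → i ≠ j → w i < w j) (hB' : ∀ i j, B i j ≠ 0 → i ≠ j → w i < w j)
    (hs : ∀ j k, ∑ i, A i j * B i k = ∑ i, A i k * B i j) (j k : I) : A j k = B j k := by
  induction hn : w j using Nat.strong_induction_on generalizing j k with
  | _ n ih =>
  have h1 := hs j k
  rw [← add_sum_erase _ _ (mem_univ j), ← add_sum_erase univ (fun i => A i k * B i j) (mem_univ j),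
    hA, hB, one_mul, mul_one] at h1
  have h2 : ∑ i ∈ univ.erase j, A i j * B i k = ∑ i ∈ univ.erase j, A i k * B i j := by
    refine sum_congr rfl fun i hi => ?_
    have hne := ne_of_mem_erase hi
    by_cases hlt : w i < w j
    · rw [ih (w i) (hn ▸ hlt) i j rfl, ih (w i) (hn ▸ hlt) i k rfl, mul_comm]
    · have h3 : A i j = 0 := by
        by_contra h
        exact hlt (hA' i j h hne)
      have h4 : B i j = 0 := by
        by_contra h
        exact hlt (hB' i j h hne)
      rw [h3, h4]; ring
  linarith

theorem colLen_eq_card_rowVec {d : ℕ} {κ : YoungDiagram} (hκ : κ.card = d) (j : ℕ) :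
    κ.colLen j = #{k | j < rowVec d κ k} := by
  have : #{k | j < rowVec d κ k} = #{k : Fin d | (k : ℕ) < κ.colLen j} := by
    congr 1
    ext k
    simp only [mem_filter, mem_univ, true_and]
    exact lt_rowLen_iff_lt_colLen
  rw [this, Fin.card_filter_val_lt, min_eq_right (hκ ▸ colLen_le_card κ j)]

/-- Expanding `h_λ` first in Schur functions and then in Hall–Littlewood functions. -/
theorem prod_completeSym_eq_sum_sum {F : Type} [Field F] {N : ℕ} {t : F}
    (ht : ∀ m, evalAt t (vFactor m) ≠ 0) {x : Fin N → F} (hx : Function.Injective x)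
    (hx0 : ∀ i, x i ≠ 0) {n : ℕ} (lam : Fin n → ℕ) :
    ∏ k, completeSym (lam k) x =
      ∑ μ ∈ partitionsOf (∑ k, lam k), evalAt t (∑ η ∈ partitionsOf (∑ k, lam k),
        C ((chainCoeff lam η).eval 0) * schurToHL η μ) * hlP t x μ := by
  rw [prod_completeSym evalAt_zero_vFactor hx hx0 lam]
  simp only [map_sum, sum_mul]
  rw [sum_comm]
  refine sum_congr rfl fun η hη => ?_
  rw [(isUniversalExpansion_schurToHL η).expansion ht hx hx0, mem_partitionsOf.1 hη, mul_sum]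
  refine sum_congr rfl fun μ _ => ?_
  rw [map_mul, evalAt_intC, evalAt_zero, mul_assoc]

theorem eval_one_chainCoeff_eq_sum {d : ℕ} {κ μ : YoungDiagram} (hκ : κ.card = d)
    (hμ : μ.card = d) :
    (chainCoeff (rowVec d κ) μ).eval 1 = ∑ η ∈ partitionsOf d,
      (chainCoeff (rowVec d κ) η).eval 0 * (schurToHL η μ).eval 1 := by
  have h1 := prod_completeSym (t := (1 : RatField d)) evalAt_one_vFactor_ne_zero xvar_injective
    xvar_ne_zero (rowVec d κ)
  have h2 := prod_completeSym_eq_sum_sum (t := (1 : RatField d)) evalAt_one_vFactor_ne_zero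
    xvar_injective xvar_ne_zero (rowVec d κ)
  rw [prod_completeSym_xvar, sum_rowVec hκ] at h1 h2
  simp only [evalAt_one, ← coeffHom_intC] at h1 h2
  have h3 := eq_coeff_of_sum_hlP_one le_rfl (fun μ => C ((chainCoeff (rowVec d κ) μ).eval 1)) _
    h1.symm hμ
  have h4 := eq_coeff_of_sum_hlP_one le_rfl (fun μ => C ((∑ η ∈ partitionsOf d,
    C ((chainCoeff (rowVec d κ) η).eval 0) * schurToHL η μ).eval 1)) _ h2.symm hμ
  have h5 := C_injective (h3.trans h4.symm)
  rw [h5, eval_finsetSum]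
  exact sum_congr rfl fun η _ => by rw [eval_mul, eval_C]

/-- The coefficient of `s_η` in `h_κ` is the value at `q = 1` of the entry `K_{ηκ}(q)` of the
transition matrix. Both matrices are unitriangular, and `eq_of_transpose_mul_symm` applies because
their product counts nonnegative integer matrices with given row and column sums. -/
theorem eval_zero_chainCoeff_eq {d : ℕ} {η κ : YoungDiagram} (hη : η.card = d)
    (hκ : κ.card = d) :
    (chainCoeff (rowVec d κ) η).eval 0 = (schurToHL η κ).eval 1 := by
  classical
  have key := eq_of_transpose_mul_symm (I := partitionsOf d) (fun η => dominanceWeight d η)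
    (fun η κ => (chainCoeff (rowVec d κ) η).eval 0) (fun η κ => (schurToHL η κ).eval 1)
    (fun κ => eval_zero_chainCoeff_self _ (colLen_eq_card_rowVec (mem_partitionsOf.1 κ.2)))
    (fun κ => by simp [(isUniversalExpansion_schurToHL (κ : YoungDiagram)).diag])
    (fun η κ h hne => ?_) (fun η κ h hne => ?_) (fun κ μ => ?_)
    ⟨η, mem_partitionsOf.2 hη⟩ ⟨κ, mem_partitionsOf.2 hκ⟩
  · exact key
  · have hη' := mem_partitionsOf.1 η.2
    have hκ' := mem_partitionsOf.1 κ.2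
    refine dominanceWeight_lt hη' hκ' (fun j => ?_) fun h => hne (Subtype.ext h)
    refine (colSum_le_of_chainCoeff_ne_zero h (hη'.trans (sum_rowVec hκ').symm) j).trans_eq ?_
    rw [sum_min_eq_sum_card]
    exact sum_congr rfl fun i _ => (colLen_eq_card_rowVec hκ' i).symm
  · exact dominanceWeight_lt_of_schurToHL_ne_zero (mem_partitionsOf.1 η.2)
      (fun h0 => h (by rw [h0, eval_zero])) fun h => hne (Subtype.ext h)
  · have hκ' := mem_partitionsOf.1 κ.2
    have hμ' := mem_partitionsOf.1 μ.2
    have h1 := eval_one_chainCoeff_comm hκ' hμ'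
    rw [eval_one_chainCoeff_eq_sum hκ' hμ', eval_one_chainCoeff_eq_sum hμ' hκ', ← sum_coe_sort,
      ← sum_coe_sort (partitionsOf d)] at h1
    exact h1

/-! ### Schur polynomials and Kostka–Foulkes polynomials -/

theorem prod_filter_lt_eq {B : Type*} [CommMonoid B] {N : ℕ} (f : Fin N → Fin N → B) :
    ∏ p : Fin N × Fin N with p.1 < p.2, f p.1 p.2 = ∏ i, ∏ j ∈ Ioi i, f i j := by
  rw [prod_filter, Fintype.prod_prod_type]
  refine prod_congr rfl fun i _ => ?_
  rw [← prod_filter]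
  congr 1
  ext j
  simp

theorem det_pow_rev {R : Type*} [CommRing R] {N : ℕ} (x : Fin N → R) :
    (Matrix.of fun i j : Fin N => x i ^ (N - 1 - (j : ℕ))).det =
      ∏ p : Fin N × Fin N with p.1 < p.2, (x p.1 - x p.2) := by
  have h := Matrix.det_projVandermonde (fun _ => (1 : R)) x
  rw [prod_filter_lt_eq (fun i j => x i - x j)]
  simp only [one_mul] at h
  rw [← h]
  congr 1
  ext i j
  rw [Matrix.projVandermonde_apply, Matrix.of_apply, one_pow, one_mul, Fin.val_rev]
  congr 1
  omega

/-- At `t = 0`, the Hall–Littlewood sum is a quotient of alternants. -/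
theorem hlSum_zero {F : Type*} [Field F] {N : ℕ} (x : Fin N → F) (α : Fin N → ℕ) :
    hlSum 0 x α = (Matrix.of fun i j : Fin N => x i ^ (α j + (N - 1 - (j : ℕ)))).det /
      (Matrix.of fun i j : Fin N => x i ^ (N - 1 - (j : ℕ))).det := by
  set V := (Matrix.of fun i j : Fin N => x i ^ (N - 1 - (j : ℕ))).det with hV
  have hsign : ∀ w : Equiv.Perm (Fin N),
      ∏ p : Fin N × Fin N with p.1 < p.2, (x (w p.1) - x (w p.2)) =
        ((Equiv.Perm.sign w : ℤ) : F) * V := by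
    intro w
    rw [← det_pow_rev fun i => x (w i), hV, ← Matrix.det_permute]
    rfl
  rw [hlSum, Matrix.det_apply', sum_div]
  refine sum_congr rfl fun w _ => ?_
  rw [hlKernel]
  simp only [zero_mul, sub_zero]
  rw [prod_div_distrib, hsign, prod_filter_lt_eq (fun i _ => x (w i))]
  simp only [prod_const, Fin.card_Ioi, Matrix.of_apply, pow_add, prod_mul_distrib]
  rcases Int.units_eq_one_or (Equiv.Perm.sign w) with h | h <;> rw [h]
  · simp; ring
  · simp only [Units.val_neg, Units.val_one, Int.cast_neg, Int.cast_one, neg_mul, one_mul]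
    rw [div_neg]; ring

theorem schurPoly_eq (N : ℕ) (μ : YoungDiagram) : schurPoly N μ = hlP 0 (xvar N) μ := by
  have h1 : evalAt (0 : RatField N) (vPoly N μ) = 1 := by
    rw [evalAt_zero, vPoly, eval_prod]
    simp
  rw [schurPoly, hlP, h1, inv_one, one_mul, hlSum_zero]

theorem hallLittlewoodP_eq (N : ℕ) (μ : YoungDiagram) :
    hallLittlewoodP N μ = hlP (coeffHom N X) (xvar N) μ := by
  rw [hallLittlewoodP, hlP, evalAt_coeffHom_X]
  rfl

theorem isHallLittlewoodExpansion_schurToHL (η : YoungDiagram) :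
    IsHallLittlewoodExpansion η (schurToHL η) := by
  have h := isUniversalExpansion_schurToHL η
  refine ⟨fun μ hμ => ?_, fun N => ?_⟩
  · by_contra h0
    exact hμ (h.card_eq μ h0)
  · rw [schurPoly_eq, h.expansion evalAt_coeffHom_vFactor_ne_zero xvar_injective xvar_ne_zero]
    exact sum_congr rfl fun κ _ => by rw [hallLittlewoodP_eq, evalAt_coeffHom_X]

/-- Hall–Littlewood expansions are unique, so the Kostka–Foulkes polynomials are the entries of the
universal transition matrix. -/
theorem kostkaFoulkes_eq (η μ : YoungDiagram) : kostkaFoulkes η μ = schurToHL η μ := by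
  have hex : ∃ c, IsHallLittlewoodExpansion η c := ⟨_, isHallLittlewoodExpansion_schurToHL η⟩
  rw [kostkaFoulkes, dif_pos hex]
  have h1 := hex.choose_spec
  have h2 := isHallLittlewoodExpansion_schurToHL η
  by_cases hμ : μ.card = η.card
  · have h3 := (h1.2 η.card).symm.trans (h2.2 η.card)
    rw [← sub_eq_zero, ← sum_sub_distrib] at h3
    refine sub_eq_zero.1 (eq_zero_of_sum_hlP le_rfl
      (fun κ => hex.choose κ - schurToHL η κ) ?_ hμ)
    rw [← h3]
    exact sum_congr rfl fun κ _ => by rw [map_sub, hallLittlewoodP_eq, sub_mul]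
  · rw [h1.1 μ hμ, h2.1 μ hμ]

theorem colLen_sortedDiagram {n : ℕ} (lam : Fin n → ℕ) : (sortedDiagram lam).colLen 0 ≤ n := by
  by_contra! h
  have h1 := YoungDiagram.mem_iff_lt_colLen.2 h
  rw [sortedDiagram, YoungDiagram.mem_ofRowLens] at h1
  obtain ⟨h2, -⟩ := h1
  simp at h2

theorem map_rowLen_sortedDiagram {n : ℕ} (lam : Fin n → ℕ) :
    (univ : Finset (Fin n)).val.map (fun i : Fin n => (sortedDiagram lam).rowLen i) =
      univ.val.map lam := by
  set l := (univ.val.map lam).sort (· ≥ ·) with hl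
  have hlen : l.length = n := by simp [hl]
  have h1 : (l : Multiset ℕ) = univ.val.map lam := Multiset.sort_eq _ _
  rw [← h1, Fin.univ_val_map]
  congr 1
  refine List.ext_getElem (by simp [hlen]) fun i hi hi' => ?_
  rw [List.getElem_ofFn]
  exact YoungDiagram.rowLen_ofRowLens (⟨i, hi'⟩ : Fin l.length)

theorem card_sortedDiagram {n : ℕ} (lam : Fin n → ℕ) :
    (sortedDiagram lam).card = ∑ k, lam k := by
  rw [card_eq_sum_rowLen _ (colLen_sortedDiagram lam)]
  exact congrArg Multiset.sum (map_rowLen_sortedDiagram lam)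

theorem prod_rowVec_sortedDiagram {B : Type*} [CommMonoid B] {n d : ℕ} (lam : Fin n → ℕ)
    (hd : ∑ k, lam k = d) (f : ℕ → B) (hf : f 0 = 1) :
    ∏ k, f (rowVec d (sortedDiagram lam) k) = ∏ k, f (lam k) := by
  have h1 : ∏ k, f (lam k) = ∏ i : Fin n, f ((sortedDiagram lam).rowLen i) := by
    have := congrArg (fun s : Multiset ℕ => (s.map f).prod) (map_rowLen_sortedDiagram lam)
    simp only [Multiset.map_map] at this
    exact this.symm
  have h2 : ∀ M, (sortedDiagram lam).colLen 0 ≤ M →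
      ∏ i ∈ range M, f ((sortedDiagram lam).rowLen i) =
        ∏ i ∈ range ((sortedDiagram lam).colLen 0), f ((sortedDiagram lam).rowLen i) := by
    intro M hM
    refine (prod_subset (range_subset_range.2 hM) fun i _ hi => ?_).symm
    rw [mem_range, ← lt_rowLen_iff_lt_colLen] at hi
    rw [Nat.eq_zero_of_not_pos hi, hf]
  rw [h1, ← prod_range fun i => f ((sortedDiagram lam).rowLen i), h2 n (colLen_sortedDiagram lam),
    ← h2 d ?_, prod_range]
  · rfl
  · rw [← hd, ← card_sortedDiagram]; exact colLen_le_card _ 0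

theorem kostkaNumber_eq {n : ℕ} (lam : Fin n → ℕ) {η : YoungDiagram}
    (hη : η.card = ∑ k, lam k) : kostkaNumber η lam =
      (chainCoeff (rowVec (∑ k, lam k) (sortedDiagram lam)) η).eval 0 := by
  rw [kostkaNumber, kostkaFoulkes_eq, eval_zero_chainCoeff_eq hη (card_sortedDiagram lam)]

/-- The coefficient of `P_μ` in `h_λ`, computed through Schur functions. The product `h_λ` does not
depend on the order of the factors, so `λ` may be sorted for the first expansion. -/
theorem chainCoeff_eq_sum_kostka {n : ℕ} (lam : Fin n → ℕ) {μ : YoungDiagram}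
    (hμ : μ.card = ∑ k, lam k) : chainCoeff lam μ = ∑ η ∈ partitionsOf (∑ k, lam k),
      C (kostkaNumber η lam) * kostkaFoulkes η μ := by
  set d := ∑ k, lam k with hd
  have h1 := prod_completeSym (evalAt_coeffHom_vFactor_ne_zero (N := d)) xvar_injective
    xvar_ne_zero lam
  have h2 := prod_completeSym_eq_sum_sum (evalAt_coeffHom_vFactor_ne_zero (N := d)) xvar_injective
    xvar_ne_zero (rowVec d (sortedDiagram lam))
  rw [prod_rowVec_sortedDiagram lam hd.symm (fun r => completeSym r (xvar d)) (completeSym_zero _),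
    h1, sum_rowVec (card_sortedDiagram lam), ← hd, ← sub_eq_zero, ← sum_sub_distrib] at h2
  have h3 := eq_zero_of_sum_hlP le_rfl (fun μ => chainCoeff lam μ - ∑ η ∈ partitionsOf d,
    C ((chainCoeff (rowVec d (sortedDiagram lam)) η).eval 0) * schurToHL η μ) (by
      rw [← h2]
      exact sum_congr rfl fun κ _ => by rw [evalAt_coeffHom_X, evalAt_coeffHom_X, map_sub, sub_mul])
    hμ
  rw [sub_eq_zero.1 h3]
  exact sum_congr rfl fun η hη => by
    rw [kostkaNumber_eq lam (mem_partitionsOf.1 hη), kostkaFoulkes_eq]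

theorem kostkaNumber_eq_zero {n : ℕ} (lam : Fin n → ℕ) {η : YoungDiagram} (h : n < η.colLen 0) :
    kostkaNumber η lam = 0 := by
  by_contra h0
  rw [kostkaNumber, kostkaFoulkes_eq] at h0
  have h1 := (isUniversalExpansion_schurToHL η).colSum_le (sortedDiagram lam)
    (fun h2 => h0 (by rw [h2, eval_zero])) 1
  have h2 := colLen_sortedDiagram lam
  simp only [colSum, sum_range_one] at h1
  omega

/-! ### Chains of diagrams -/

theorem mem_diagramChains {n : ℕ} {μ : YoungDiagram} {lam : Fin n → ℕ}
    (hlam : ∑ k, lam k = μ.card) {ν : Fin (n + 1) → YoungDiagram} :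
    ν ∈ diagramChains μ lam ↔ ν (Fin.last n) = μ.transpose ∧
      (∀ a : Fin n, ν a.castSucc ≤ ν a.succ) ∧
      ∀ a : Fin (n + 1), (ν a).card = ∑ k : Fin n with k.val < a.val, lam k := by
  constructor
  · rintro ⟨h0, h1, h2, h3⟩
    refine ⟨h1, h2, fun a => ?_⟩
    by_cases ha : 1 ≤ (a : ℕ)
    · by_cases ha' : (a : ℕ) ≤ n - 1
      · exact h3 a ha ha'
      · obtain rfl : a = Fin.last n := Fin.ext (by have := a.2; simp only [Fin.val_last]; omega)
        rw [h1, card_transpose, ← hlam]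
        simp
    · obtain rfl : a = 0 := Fin.ext (by simp only [Fin.val_zero]; omega)
      rw [h0]
      simp
  · rintro ⟨h1, h2, h3⟩
    refine ⟨card_eq_zero_iff.1 ?_, h1, h2, fun a _ _ => h3 a⟩
    rw [h3]
    simp

theorem sum_filter_lt_castSucc {n : ℕ} (lam : Fin (n + 1) → ℕ) (a : Fin (n + 1)) :
    ∑ k : Fin (n + 1) with k.val < a.castSucc.val, lam k =
      ∑ k : Fin n with k.val < a.val, Fin.init lam k := by
  rw [sum_filter, sum_filter, Fin.sum_univ_castSucc]
  have : ¬n < (a : ℕ) := by have := a.2; omega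
  simp [this, Fin.init]

/-- The iterated Pieri coefficients as sums over chains. The chains consist of conjugate
partitions. -/
theorem chainCoeff_eq_sum {n : ℕ} {μ : YoungDiagram} {lam : Fin n → ℕ}
    (hlam : ∑ k, lam k = μ.card) :
    chainCoeff lam μ = ∑ ν ∈ (finite_diagramChains μ lam).toFinset,
      ∏ a : Fin n, hStrip (ν a.succ).transpose (ν a.castSucc).transpose := by
  classical
  induction n generalizing μ with
  | zero =>
    have hμ : μ.card = 0 := by rw [← hlam]; simp
    have hset : (finite_diagramChains μ lam).toFinset = {fun _ => ⊥} := by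
      ext ν
      rw [Set.Finite.mem_toFinset, mem_diagramChains hlam, mem_singleton]
      constructor
      · rintro ⟨-, -, h⟩
        funext a
        exact card_eq_zero_iff.1 ((h a).trans (by simp))
      · rintro rfl
        refine ⟨?_, fun a => a.elim0, fun a => ?_⟩
        · exact (card_eq_zero_iff.1 ((card_transpose μ).trans hμ)).symm
        · simp
    rw [hset, sum_singleton]
    simp [chainCoeff, hμ]
  | succ n ih =>
    rw [chainCoeff_succ]
    have h1 : ∀ τ ∈ partitionsOf (∑ k, Fin.init lam k),
        chainCoeff (Fin.init lam) τ * hStrip μ τ =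
          ∑ ν ∈ (finite_diagramChains τ (Fin.init lam)).toFinset,
            (∏ a : Fin n, hStrip (ν a.succ).transpose (ν a.castSucc).transpose) * hStrip μ τ := by
      intro τ hτ
      rw [ih (mem_partitionsOf.1 hτ).symm, sum_mul]
    rw [sum_congr rfl h1, sum_sigma']
    have hval : ∀ ν ∈ (finite_diagramChains μ lam).toFinset,
        ∏ a : Fin (n + 1), hStrip (ν a.succ).transpose (ν a.castSucc).transpose =
          (∏ a : Fin n, hStrip (Fin.init ν a.succ).transpose (Fin.init ν a.castSucc).transpose) *
            hStrip μ (ν (Fin.last n).castSucc).transpose := by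
      intro ν hν
      rw [Set.Finite.mem_toFinset, mem_diagramChains hlam] at hν
      rw [Fin.prod_univ_castSucc, Fin.succ_last, hν.1, YoungDiagram.transpose_transpose]
      rfl
    symm
    refine sum_bij_ne_zero (fun ν _ _ => ⟨(ν (Fin.last n).castSucc).transpose, Fin.init ν⟩)
      ?_ ?_ ?_ ?_
    · intro ν hν _
      rw [Set.Finite.mem_toFinset, mem_diagramChains hlam] at hν
      have hcard : ((ν (Fin.last n).castSucc).transpose).card = ∑ k, Fin.init lam k := by
        rw [card_transpose, hν.2.2, sum_filter_lt_castSucc]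
        simp
      rw [mem_sigma, mem_partitionsOf, Set.Finite.mem_toFinset, mem_diagramChains hcard.symm]
      refine ⟨hcard, ?_, fun a => hν.2.1 a.castSucc, fun a => ?_⟩
      · rw [YoungDiagram.transpose_transpose]; rfl
      · rw [← sum_filter_lt_castSucc]
        exact hν.2.2 a.castSucc
    · intro ν hν _ ν' hν' _ h
      rw [Set.Finite.mem_toFinset, mem_diagramChains hlam] at hν hν'
      have h2 : Fin.init ν = Fin.init ν' := eq_of_heq (Sigma.mk.inj_iff.1 h).2
      rw [← Fin.snoc_init_self ν, ← Fin.snoc_init_self ν', h2, hν.1, hν'.1]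
    · rintro ⟨τ, ν⟩ h hne
      rw [mem_sigma, mem_partitionsOf, Set.Finite.mem_toFinset] at h
      obtain ⟨hτ, hν⟩ := h
      rw [mem_diagramChains hτ.symm] at hν
      simp only at hν hne
      have hle : τ ≤ μ := le_of_hStrip_ne_zero (right_ne_zero_of_mul hne)
      let ν' : Fin (n + 1 + 1) → YoungDiagram :=
        Fin.snoc (α := fun _ => YoungDiagram) ν μ.transpose
      have hinit : Fin.init ν' = ν := Fin.init_snoc (α := fun _ => YoungDiagram) _ _
      have hlast : ν' (Fin.last _) = μ.transpose := Fin.snoc_last (α := fun _ => YoungDiagram) _ _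
      have hcs : ∀ a : Fin (n + 1), ν' a.castSucc = ν a := fun a => congrFun hinit a
      have hmem : ν' ∈ (finite_diagramChains μ lam).toFinset := by
        rw [Set.Finite.mem_toFinset, mem_diagramChains hlam]
        refine ⟨hlast, fun a => ?_, fun a => ?_⟩
        · refine Fin.lastCases ?_ (fun a => ?_) a
          · rw [Fin.succ_last, hlast, hcs, hν.1]
            exact YoungDiagram.transpose_mono hle
          · rw [hcs, Fin.succ_castSucc, hcs]
            exact hν.2.1 a
        · refine Fin.lastCases ?_ (fun a => ?_) a
          · rw [hlast, card_transpose, ← hlam, filter_true_of_mem fun k _ => k.2]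
          · rw [hcs, sum_filter_lt_castSucc]
            exact hν.2.2 a
      have hτ' : (ν' (Fin.last n).castSucc).transpose = τ := by
        rw [hcs, hν.1, YoungDiagram.transpose_transpose]
      refine ⟨ν', hmem, ?_, ?_⟩
      · rw [hval ν' hmem, hτ', hinit]
        exact hne
      · rw [hτ', hinit]
    · intro ν hν _
      exact hval ν hν

/-- The product of Pieri coefficients along a chain is the contribution of the chain. -/
theorem algebraMap_prod_hStrip {n : ℕ} {μ : YoungDiagram} {lam : Fin n → ℕ}
    {ν : Fin (n + 1) → YoungDiagram} (hν : ν ∈ diagramChains μ lam) :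
    algebraMap ℤ[X] QField
        (∏ a : Fin n, hStrip (ν a.succ).transpose (ν a.castSucc).transpose) =
      algebraMap ℤ[X] QField (X ^ chainExponent μ ν) * chainProduct μ ν := by
  obtain ⟨h0, h1, h2, -⟩ := hν
  have hmono : Monotone ν := Fin.monotone_iff_le_succ.2 h2
  have h3 : ∀ a : Fin n, hStrip (ν a.succ).transpose (ν a.castSucc).transpose =
      X ^ (∑ i ∈ range (μ.rowLen 0),
        ((ν a.succ).rowLen i - (ν a.castSucc).rowLen i).choose 2) *
      ∏ i ∈ range (μ.rowLen 0),
        gauss ((ν a.succ).rowLen i - (ν a.castSucc).rowLen (i + 1))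
          ((ν a.castSucc).rowLen i - (ν a.castSucc).rowLen (i + 1)) := by
    intro a
    rw [hStrip_eq (YoungDiagram.transpose_mono (h2 a)) (M := μ.rowLen 0), prod_mul_distrib,
      prod_pow_eq_pow_sum]
    · simp only [YoungDiagram.colLen_transpose]
    · rw [YoungDiagram.rowLen_transpose, ← YoungDiagram.colLen_transpose μ]
      exact colLen_le_of_le (h1 ▸ hmono (Fin.le_last a.succ)) 0
  simp only [h3]
  rw [prod_mul_distrib, prod_pow_eq_pow_sum, map_mul, chainProduct, prod_filter, map_prod]
  refine congrArg₂ _ rfl (prod_congr rfl fun a _ => ?_)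
  simp only [qBinom_eq]
  split_ifs with ha
  · rw [map_prod]
  · -- The first step of a chain starts at the empty diagram and contributes trivial binomials.
    have ha0 : a.castSucc = 0 := Fin.ext (by simp only [Fin.val_castSucc, Fin.val_zero]; omega)
    simp [ha0, h0, rowLen_bot]

end HallLittlewood

theorem proposition4p1 {n : ℕ} (μ : YoungDiagram) (lam : Fin n → ℕ)
    (hlam : ∑ k, lam k = μ.card) :
    algebraMap ℤ[X] HallLittlewood.QField
        (∑ η ∈ HallLittlewood.partitionsOf μ.card with η.colLen 0 ≤ n,
          C (HallLittlewood.kostkaNumber η lam) * HallLittlewood.kostkaFoulkes η μ) =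
      ∑ ν ∈ (HallLittlewood.finite_diagramChains μ lam).toFinset,
        algebraMap ℤ[X] HallLittlewood.QField (X ^ HallLittlewood.chainExponent μ ν) *
          HallLittlewood.chainProduct μ ν := by
  have h1 : (∑ η ∈ HallLittlewood.partitionsOf μ.card with η.colLen 0 ≤ n,
      C (HallLittlewood.kostkaNumber η lam) * HallLittlewood.kostkaFoulkes η μ) =
        HallLittlewood.chainCoeff lam μ := by
    rw [HallLittlewood.chainCoeff_eq_sum_kostka lam hlam.symm, hlam]
    refine sum_filter_of_ne fun η _ hne => ?_
    by_contra! h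
    exact hne (by rw [HallLittlewood.kostkaNumber_eq_zero lam h, map_zero, zero_mul])
  rw [h1, HallLittlewood.chainCoeff_eq_sum hlam, map_sum]
  refine sum_congr rfl fun ν hν => ?_
  exact HallLittlewood.algebraMap_prod_hStrip ((Set.Finite.mem_toFinset _).1 hν)
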